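/- Let $n>1$, let $F_n$ be the free group with basis $\mathcal A_n=\{a_1,\dots,a_n\}$, and let $U=(u_1,\dots,u_r)$ be a list (repetitions allowed) of cyclically reduced words in $F_n$; that is, $u=x_1x_2\cdots x_l$ with letters $x_i\in\mathcal A_n\cup\mathcal A_n^{-1}$ and $x_{i+1}\neq x_i^{-1}$ for all $i$, where subscripts are taken modulo $l$. *Whitehead graph.* $W(U)$ is the graph (parallel edges allowed) with vertex set $\mathcal A_n\cup\mathcal A_n^{-1}$ which has, for each word $x_1\cdots x_l$ in the list $U$ and each $i$, one edge joining $x_i$ and $x_{i+1}^{-1}$. For a vertex $v$, let $\delta(v)$ be the set of edges incident with $v$. The connecting map $\sigma_v\colon\delta(v)\to\delta(v^{-1})$ is the bijection such that $\sigma_{x_{i+1}^{-1}}$ sends the edge given by $x_ix_{i+1}$ to the edge given by $x_{i+1}x_{i+2}$ in the same word, and $\sigma_{x_{i+1}}$ sends the latter back to the former. A cycle is a finite connected $2$-regular graph (so two parallel edges form a cycle of length $2$); a cycle of $W(U)$ is a subgraph of $W(U)$ that is a cycle. *Polygonality.* A polygonal disk is a $2$-disk whose boundary circle is subdivided into a positive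 number of sides. A side-pairing $\sim$ on polygonal disks $P_1,\dots,P_m$ is an equivalence relation on their sides all of whose classes consist of exactly two sides, together with a homeomorphism between the two sides of each class; the quotient $S=\coprod_iP_i/\!\sim$ is a closed surface with a natural CW-structure. Let $R_n$ be the bouquet of $n$ oriented circles $\alpha_1,\dots,\alpha_n$, where $\alpha_j$ reads $a_j$. The list $U$ is called polygonal if there are a side-pairing on some polygonal disks $P_1,\dots,P_m$ and a locally injective graph map $S^{(1)}\to R_n$ such that (i) for each $i$ the composition $\partial P_i\to S^{(1)}\to R_n$ reads, for a suitable starting point and direction, a nontrivial power of a word in $U$, and (ii) $\chi(S)<m$. **Statement.** $U$ is polygonal if and only if there is a nonempty finite list of cycles of $W(U)$ (repetitions allowed) such that at least one of the cycles has length at least $3$ and, for every vertex $v$ of $W(U)$ and all edges $e,f\in\delta(v)$, the number of cycles in the list containing both $e$ and $f$ equals the number of cycles in the list containing both $\sigma_v(e)$ and $\sigma_v(f)$. -/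

import Mathlib

namespace Polygonality

/-! ### Letters -/

/-- The letters of the free group on `Fin n`, in Mathlib's convention for words:
`(i, true)` is the generator `a_i` and `(i, false)` is its inverse. -/
abbrev Letter (n : ℕ) : Type := Fin n × Bool

/-- The inverse letter. As a map on the vertices of the Whitehead graph this is the canonical
fixed point free involution. -/
def Letter.bar {n : ℕ} (x : Letter n) : Letter n := (x.1, !x.2)

/-! ### Cycles in multigraphs -/

/-- The degree of a vertex of a multigraph: the number of incident edges, loops counted twice.
(Used for finite graphs.) -/
noncomputable def degree {α β : Type*} (G : Graph α β) (v : α) : ℕ :=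
  {e | G.IsNonloopAt e v}.ncard + 2 * {e | G.IsLoopAt e v}.ncard

/-- A multigraph is connected if it has a vertex and any two of its vertices can be joined by a
chain of adjacent vertices. -/
def Connected {α β : Type*} (G : Graph α β) : Prop :=
  G.vertexSet.Nonempty ∧
    ∀ x ∈ G.vertexSet, ∀ y ∈ G.vertexSet, Relation.ReflTransGen G.Adj x y

/-- A cycle is a finite connected `2`-regular multigraph. In particular two vertices joined by
two parallel edges form a cycle of length `2`. -/
structure IsCycle {α β : Type*} (C : Graph α β) : Prop where
  finite_vertexSet : C.vertexSet.Finite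
  finite_edgeSet : C.edgeSet.Finite
  connected : Connected C
  degree_eq_two : ∀ v ∈ C.vertexSet, degree C v = 2

/-- The length of a cycle: its number of edges. -/
noncomputable def cycleLength {α β : Type*} (C : Graph α β) : ℕ := C.edgeSet.ncard

/-! ### The Whitehead graph and its connecting maps -/

section Whitehead

variable {n : ℕ} (U : List (FreeGroup (Fin n)))

/-- The edges of the Whitehead graph of `U`. There is one for each word of the list and each
position `j` in it: the one of the length-`2` cyclic subword `x_j x_{j+1}`. -/
abbrev WhiteheadEdge : Type := Σ i : Fin U.length, Fin (U.get i).toWord.length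

variable {U}

/-- The edge of the following length-`2` cyclic subword of the same word: `x_{j+1} x_{j+2}`
for `x_j x_{j+1}`, subscripts being cyclic. -/
def WhiteheadEdge.next (e : WhiteheadEdge U) : WhiteheadEdge U :=
  ⟨e.1, finRotate _ e.2⟩

/-- The edge of the preceding length-`2` cyclic subword of the same word. -/
def WhiteheadEdge.prev (e : WhiteheadEdge U) : WhiteheadEdge U :=
  ⟨e.1, (finRotate _).symm e.2⟩

/-- The first letter `x` of the length-`2` cyclic subword `xy` of an edge. -/
def WhiteheadEdge.firstLetter (e : WhiteheadEdge U) : Letter n :=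
  (U.get e.1).toWord.get e.2

/-- The second letter `y` of the length-`2` cyclic subword `xy` of an edge. -/
def WhiteheadEdge.secondLetter (e : WhiteheadEdge U) : Letter n :=
  e.next.firstLetter

variable (U)

/-- The Whitehead graph `W(U)`: its vertices are the generators and their inverses, and each
length-`2` cyclic subword `xy` of a word in `U` gives an edge joining `x` and `y⁻¹`. -/
def whiteheadGraph : Graph (Letter n) (WhiteheadEdge U) where
  vertexSet := Set.univ
  IsLink e x y := (x = e.firstLetter ∧ y = e.secondLetter.bar) ∨ (x = e.secondLetter.bar ∧ y = e.firstLetter)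
  isLink_symm := by
    intro e _
    constructor
    rintro x y (⟨h, h'⟩ | ⟨h, h'⟩)
    · exact Or.inr ⟨h', h⟩
    · exact Or.inl ⟨h', h⟩
  eq_or_eq_of_isLink_of_isLink := by
    rintro e x y v w (⟨rfl, rfl⟩ | ⟨rfl, rfl⟩) (⟨rfl, rfl⟩ | ⟨rfl, rfl⟩) <;> simp
  left_mem_of_isLink := by
    intro e x y _
    exact Set.mem_univ x

/-- The connecting map `σ_v` at the vertex `v`, from the edges at `v` to the edges at `v⁻¹`.
The edge of `x_j x_{j+1}` joins `x_j` and `x_{j+1}⁻¹`; the connecting map at `x_{j+1}⁻¹` sends it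
to the edge of `x_{j+1} x_{j+2}`, and the connecting map at `x_j`, which is the inverse of the one
at `x_j⁻¹`, sends it to the edge of `x_{j-1} x_j`. Only the values at edges incident with `v` are
meaningful. -/
def connectingMap (v : Letter n) (e : WhiteheadEdge U) : WhiteheadEdge U :=
  if v = e.secondLetter.bar then e.next else e.prev

end Whitehead

/-! ### Polygonal disks, side-pairings and closed surfaces -/

/-- A finite list of polygonal disks `P_1, …, P_m`: the boundary of each of them is subdivided
into a positive number of sides. -/
structure Disks where
  /-- The number `m` of disks. -/
  num : ℕ
  /-- The number of sides of each disk. -/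
  sides : Fin num → ℕ
  sides_pos : ∀ i, 0 < sides i

namespace Disks

variable (P : Disks)

/-- The sides of all the disks. The boundary of the `i`-th disk is traversed along its sides
`⟨i, 0⟩, ⟨i, 1⟩, …` in this cyclic order. -/
abbrev Side : Type := Σ i : Fin P.num, Fin (P.sides i)

/-- The vertices on the boundaries of all the disks; `⟨i, k⟩` is the one at which the boundary
traversal of the `i`-th disk enters the side `⟨i, k⟩`. -/
abbrev Corner : Type := Σ i : Fin P.num, Fin (P.sides i)

/-- Oriented sides: `(s, true)` is `s` with the orientation of the boundary traversal and
`(s, false)` is `s` with the opposite orientation. -/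
abbrev Dart : Type := P.Side × Bool

variable {P}

/-- The initial vertex of an oriented side. -/
def source (d : P.Dart) : P.Corner :=
  if d.2 then d.1 else ⟨d.1.1, finRotate _ d.1.2⟩

/-- The opposite orientation of the same side. -/
def reverse (d : P.Dart) : P.Dart := (d.1, !d.2)

end Disks

/-- A side-pairing on polygonal disks: the sides are grouped into classes of two, and the two sides
of each class are identified by a homeomorphism. Combinatorially, the homeomorphism is recorded by
whether it reverses or preserves the orientations of the sides given by the boundary
traversals. -/
structure SidePairing (P : Disks) where
  /-- The other side in the class of a side. -/
  mate : P.Side → P.Side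
  mate_mate : ∀ s, mate (mate s) = s
  mate_ne : ∀ s, mate s ≠ s
  /-- Whether the homeomorphism from `s` to `mate s` reverses the boundary orientations. -/
  reverses : P.Side → Bool
  reverses_mate : ∀ s, reverses (mate s) = reverses s

namespace SidePairing

variable {P : Disks} (S : SidePairing P)

/-- The oriented side with which an oriented side is identified. -/
def glue (d : P.Dart) : P.Dart :=
  (S.mate d.1, if S.reverses d.1 then !d.2 else d.2)

/-- The vertices of the closed surface `S = ∐ P_i / ∼`: the quotient of the vertices of the disks
by the equivalence relation generated by the identification of sides. -/
def Vertex : Type :=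
  Quot fun p q : P.Corner => ∃ d : P.Dart, p = Disks.source d ∧ q = Disks.source (S.glue d)

/-- The vertex of the surface that is the image of a vertex of a disk. -/
def vertex (p : P.Corner) : S.Vertex := Quot.mk _ p

/-- The edges of the closed surface `S = ∐ P_i / ∼`. -/
def Edge : Type := Quot fun s t : P.Side => t = S.mate s

/-- The Euler characteristic `χ(S)` of the closed surface `S = ∐ P_i / ∼`, computed from its
natural CW-structure, the `2`-cells of which are the disks. -/
noncomputable def eulerChar : ℤ :=
  (Nat.card S.Vertex : ℤ) - (Nat.card S.Edge : ℤ) + (P.num : ℤ)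

/-- A graph map from the `1`-skeleton of the surface to the bouquet of `n` oriented circles (the
quotient of the Cayley graph of the free group). It sends each oriented edge to an oriented circle,
that is, to a letter, and opposite orientations to inverse letters. An oriented edge of the
`1`-skeleton is a class `{d, glue d}` of oriented sides. -/
structure RoseMap (n : ℕ) where
  /-- The letter read along an oriented side. -/
  letter : P.Dart → Letter n
  letter_reverse : ∀ d, letter (Disks.reverse d) = (letter d).bar
  letter_glue : ∀ d, letter (S.glue d) = letter d

namespace RoseMap

variable {S} {n : ℕ} (φ : S.RoseMap n)

/-- The graph map is an immersion, that is, locally injective: two oriented edges of the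
`1`-skeleton that issue from the same vertex and have the same image are equal. -/
def IsImmersion : Prop :=
  ∀ d d' : P.Dart, S.vertex (Disks.source d) = S.vertex (Disks.source d') →
    φ.letter d = φ.letter d' → d' = d ∨ d' = S.glue d

/-- The word read along the boundary of the `i`-th disk, starting at its `0`-th vertex. -/
def boundaryWord (i : Fin P.num) : List (Letter n) :=
  List.ofFn fun k : Fin (P.sides i) => φ.letter (⟨i, k⟩, true)

end RoseMap

end SidePairing

/-- A list `U` of words is polygonal if there are a side-pairing `S` on some polygonal disks
`P_1, …, P_m` and an immersion of the `1`-skeleton of the resulting closed surface to the bouquet of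
circles such that the boundary of each disk reads, from some starting point, a nontrivial power of a
word in `U` (negative powers correspond to the other direction), and `χ(S) < m`. -/
def IsPolygonal {n : ℕ} (U : List (FreeGroup (Fin n))) : Prop :=
  ∃ (P : Disks) (S : SidePairing P) (φ : S.RoseMap n),
    φ.IsImmersion ∧
    (∀ i : Fin P.num, ∃ u ∈ U, ∃ k : ℤ, k ≠ 0 ∧
      (φ.boundaryWord i).IsRotated (u ^ k).toWord) ∧
    S.eulerChar < (P.num : ℤ)

end Polygonality

/-! ### Periodic words -/

section PeriodicWords

/-! The dictionary is: vertices of the surface are cycles, and corners of the disks are edges of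
those cycles. A corner between an incoming side reading `x` and an outgoing side reading `y`
determines an edge of the Whitehead graph joining `x` and `y⁻¹`. Moving along a side to the next
corner applies the connecting map.

From a surface to cycles, the link of a vertex `p` maps to the Whitehead graph: an outgoing oriented
edge goes to the inverse of its letter, a corner goes to its label. Local injectivity makes this map
injective on vertices of the link, so its image is a cycle unless a link of length two folds onto a
single edge. The list consists of the unfolded links. Two edges `e`, `f` at `v` in a link lie on the
two sides of an edge of the surface, and at its other end the labels are their images under `σ_v`.
This gives the equality of counts; an edge of the surface has a folded link at one end exactly if it
has one at the other, so discarding these links is harmless. The carrying lemmas are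
`eq_or_eq_of_edge_eq`, `link_isCycle` and `ncard_embedded_le`.

Conversely, equality of counts yields for each generator a permutation of the list of cycles that
matches the edges at `v` of one cycle with those at `v⁻¹` of another (`exists_perm_edges_at`). It
extends the passage to the next letter to a permutation of the pairs (cycle, edge in it). The orbits
are the disks, and they read powers of words in `U`. A cycle has two edges at each of its vertices,
which prescribes how sides are glued, and connectedness makes each cycle the link of one vertex.

Finally `χ(S) < m` says that there are more than twice as many corners as vertices
(`eulerChar_lt_iff`). Folded links have at most two corners and cycles have length at least two, so
this corresponds to a cycle of length at least three. -/

theorem coe_finRotate_eq_mod {L : ℕ} (k : Fin L) : (finRotate L k : ℕ) = (k + 1) % L := by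
  cases L with
  | zero => exact k.elim0
  | succ m =>
    rw [coe_finRotate]
    split_ifs with h
    · subst h
      simp
    · have := k.2
      have h' : (k : ℕ) ≠ m := fun hk => h (Fin.ext hk)
      rw [Nat.mod_eq_of_lt (by lia)]

theorem coe_iterate_finRotate {L : ℕ} (k : Fin L) (m : ℕ) :
    ((finRotate L)^[m] k : ℕ) = (k + m) % L := by
  induction m with
  | zero => simp [Nat.mod_eq_of_lt k.2]
  | succ m ih =>
    rw [Function.iterate_succ_apply', coe_finRotate_eq_mod, ih, Nat.mod_add_mod, add_assoc]

theorem rev_finRotate {L : ℕ} (k : Fin L) : (finRotate L k).rev = (finRotate L).symm k.rev := by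
  rw [Equiv.eq_symm_apply]
  have hk := k.2
  ext
  rw [coe_finRotate_eq_mod, Fin.val_rev, Fin.val_rev, coe_finRotate_eq_mod]
  rcases Nat.lt_or_ge (k + 1) L with h | h
  · rw [Nat.mod_eq_of_lt h, Nat.mod_eq_of_lt (by lia)]
    lia
  · have h' : (k : ℕ) + 1 = L := by lia
    have h'' : L - (0 + 1) + 1 = L := by lia
    rw [h', Nat.mod_self, h'', Nat.mod_self, Nat.sub_self]

theorem List.getElem_flatten_replicate {α : Type*} (w : List α) (N i : ℕ)
    (h : i < (List.replicate N w).flatten.length) (h' : i % w.length < w.length) :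
    (List.replicate N w).flatten[i] = w[i % w.length] := by
  induction N generalizing i with
  | zero => simp at h
  | succ N ih =>
    simp only [List.replicate_succ, List.flatten_cons, List.getElem_append]
    split_ifs with hi
    · simp only [Nat.mod_eq_of_lt hi]
    · rw [ih]
      · simp only [← Nat.mod_eq_sub_mod (not_lt.mp hi)]
      · rwa [← Nat.mod_eq_sub_mod (not_lt.mp hi)]

/-- A cyclic word that is a power of `w` is the pull-back of `w` along a map that commutes with
rotation. -/
theorem exists_semiconj_of_isRotated_flatten_replicate {α : Type*} (w : List α) (N L : ℕ)
    (hL : 0 < L) (b : Fin L → α) (h : (List.ofFn b).IsRotated (List.replicate N w).flatten) :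
    ∃ π : Fin L → Fin w.length, (∀ k, π (finRotate L k) = finRotate _ (π k)) ∧
      ∀ k, b k = w.get (π k) := by
  obtain ⟨r, hr⟩ := h.symm
  have hlen : N * w.length = L := by
    have := congrArg List.length hr
    simpa using this
  have hw : 0 < w.length := Nat.pos_of_mul_pos_left (hlen ▸ hL)
  have hdvd : w.length ∣ L := ⟨N, by rw [← hlen, mul_comm]⟩
  -- `r` is the offset of the rotation; reduction modulo `w.length` respects the wrap-around at `L`
  -- because `w.length` divides `L`.
  refine ⟨fun k => ⟨(k + r) % w.length, Nat.mod_lt _ hw⟩, fun k => ?_, fun k => ?_⟩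
  · ext
    rw [coe_finRotate_eq_mod]
    simp only [coe_finRotate_eq_mod]
    rw [Nat.mod_add_mod, Nat.add_mod, Nat.mod_mod_of_dvd _ hdvd, ← Nat.add_mod, add_right_comm]
  · have h1 : k.1 < (List.ofFn b).length := by simp
    have h2 : (List.ofFn b)[k.1] = b k := by simp
    rw [← h2]
    simp only [← hr, List.getElem_rotate]
    rw [List.getElem_flatten_replicate _ _ _ _ (Nat.mod_lt _ hw)]
    have h3 : (List.replicate N w).flatten.length = L := by simpa using hlen
    simp only [h3, Nat.mod_mod_of_dvd _ hdvd, List.get_eq_getElem]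

/-- The pull-back of a cyclic word `w` along a map that commutes with rotation is a power
of `w`. -/
theorem isRotated_flatten_replicate_of_semiconj {α : Type*} (w : List α) (L : ℕ)
    (hL : 0 < L) (π : Fin L → Fin w.length) (hπ : ∀ k, π (finRotate L k) = finRotate _ (π k)) :
    ∃ N, N ≠ 0 ∧ (List.ofFn fun k => w.get (π k)).IsRotated (List.replicate N w).flatten := by
  let z : Fin L := ⟨0, hL⟩
  have hw : 0 < w.length := (π z).pos
  have hsemi : Function.Semiconj π (finRotate L) (finRotate w.length) := hπ
  have hval : ∀ m, ((π ((finRotate L)^[m] z)) : ℕ) = (π z + m) % w.length := fun m => by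
    rw [hsemi.iterate_right m z, coe_iterate_finRotate]
  -- `L` rotations return to the start, hence so do `L` rotations of `w`.
  have hdvd : w.length ∣ L := by
    have h1 : (finRotate L)^[L] z = z := by
      ext
      rw [coe_iterate_finRotate]
      simp [z]
    have h2 := hval L
    rw [h1] at h2
    have h3 : (π z + 0) ≡ π z + L [MOD w.length] := by
      rw [Nat.ModEq, ← h2, add_zero, Nat.mod_eq_of_lt (π z).2]
    exact (Nat.modEq_zero_iff_dvd).1 (Nat.ModEq.add_left_cancel' _ h3).symm
  obtain ⟨N, hN⟩ := hdvd
  refine ⟨N, by rintro rfl; lia, ?_⟩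
  have h3 : (List.replicate N w).flatten.length = L := by simp [hN, mul_comm]
  refine List.IsRotated.symm ⟨π z, List.ext_getElem (by simp [hN, mul_comm]) fun i h1 h2 => ?_⟩
  have hi : i < L := by simpa using h2
  have hk : (⟨i, hi⟩ : Fin L) = (finRotate L)^[i] z := by
    ext
    rw [coe_iterate_finRotate]
    simp [z, Nat.mod_eq_of_lt hi]
  rw [List.getElem_rotate, List.getElem_flatten_replicate _ _ _ _ (Nat.mod_lt _ hw)]
  simp only [List.getElem_ofFn, List.get_eq_getElem, hk, hval, h3]
  congr 1
  rw [Nat.mod_mod_of_dvd _ ⟨N, hN⟩, add_comm]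

theorem FreeGroup.IsCyclicallyReduced.toWord_pow {α : Type*} [DecidableEq α] {u : FreeGroup α}
    (hu : IsCyclicallyReduced u.toWord) (N : ℕ) :
    (u ^ N).toWord = (List.replicate N u.toWord).flatten := by
  rw [FreeGroup.toWord_pow, (hu.flatten_replicate N).isReduced.reduce_eq]

end PeriodicWords

namespace Polygonality

theorem Letter.bar_bar {n : ℕ} (x : Letter n) : x.bar.bar = x := by
  simp [Letter.bar]

theorem Letter.bar_ne {n : ℕ} (x : Letter n) : x.bar ≠ x := by
  intro h
  simpa [Letter.bar] using congrArg Prod.snd h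

theorem Letter.bar_injective {n : ℕ} : Function.Injective (Letter.bar (n := n)) :=
  Function.LeftInverse.injective Letter.bar_bar

/-- A cyclic word that is a power of a cyclically reduced word `u` is the pull-back of `u`, or the
inverse of such a pull-back, along a map that preserves or reverses the direction of rotation. -/
theorem exists_semiconj_of_isRotated_zpow {n : ℕ} {u : FreeGroup (Fin n)}
    (hu : FreeGroup.IsCyclicallyReduced u.toWord) (k : ℤ) (L : ℕ) (hL : 0 < L)
    (b : Fin L → Letter n) (h : (List.ofFn b).IsRotated (u ^ k).toWord) :
    ∃ π : Fin L → Fin u.toWord.length,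
      ((∀ j, π (finRotate L j) = finRotate _ (π j)) ∧ ∀ j, b j = u.toWord.get (π j)) ∨
      ((∀ j, π (finRotate L j) = (finRotate _).symm (π j)) ∧
        ∀ j, b j = Letter.bar (u.toWord.get (π j))) := by
  obtain ⟨N, rfl | rfl⟩ := k.eq_nat_or_neg
  · rw [zpow_natCast, hu.toWord_pow] at h
    obtain ⟨π, h1, h2⟩ := exists_semiconj_of_isRotated_flatten_replicate _ _ _ hL b h
    exact ⟨π, Or.inl ⟨h1, h2⟩⟩
  · rw [zpow_neg, zpow_natCast, FreeGroup.toWord_inv, hu.toWord_pow, FreeGroup.invRev] at h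
    -- Reading the boundary backwards with inverted letters turns a negative power into a positive
    -- one.
    have h' := (h.reverse).map Letter.bar
    rw [List.reverse_reverse, List.map_map] at h'
    have hid : Letter.bar ∘ (fun g : Fin n × Bool => (g.1, !g.2)) = id :=
      funext Letter.bar_bar
    rw [hid, List.map_id] at h'
    have hb : List.map Letter.bar (List.ofFn b).reverse
        = List.ofFn fun j : Fin L => (b j.rev).bar := by
      refine List.ext_getElem (by simp) fun i h1 h2 => ?_
      simp only [List.getElem_map, List.getElem_reverse, List.getElem_ofFn, List.length_ofFn]
      congr 2
      ext
      simp only [Fin.val_rev]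
      lia
    rw [hb] at h'
    obtain ⟨π, h1, h2⟩ := exists_semiconj_of_isRotated_flatten_replicate _ _ _ hL _ h'
    refine ⟨fun j => π j.rev, Or.inr ⟨fun j => ?_, fun j => ?_⟩⟩
    · rw [Equiv.eq_symm_apply, ← h1, rev_finRotate, Equiv.apply_symm_apply]
    · rw [← h2, Fin.rev_rev, Letter.bar_bar]

/-! ### The Whitehead graph -/

/-- Cyclic reducedness, including the wrap from the last letter to the first, is what excludes loops
from the Whitehead graph. -/
theorem get_ne_bar_get_finRotate {n : ℕ} {w : List (Letter n)}
    (hw : FreeGroup.IsCyclicallyReduced w) (j : Fin w.length) :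
    w.get j ≠ Letter.bar (w.get (finRotate _ j)) := by
  intro h
  have key : (w.get j).1 = (w.get (finRotate _ j)).1 → (w.get j).2 = (w.get (finRotate _ j)).2 := by
    obtain ⟨hr, hc⟩ := hw
    rcases Nat.lt_or_ge (j.1 + 1) w.length with hj | hj
    · have h1 : finRotate _ j = ⟨j.1 + 1, hj⟩ := by
        ext
        rw [coe_finRotate_eq_mod, Nat.mod_eq_of_lt hj]
      rw [h1]
      exact List.isChain_iff_getElem.1 hr j.1 hj
    · have hj' : j.1 + 1 = w.length := by lia
      have h1 : finRotate _ j = ⟨0, j.pos⟩ := by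
        ext
        rw [coe_finRotate_eq_mod, hj', Nat.mod_self]
      have h2 : j = ⟨w.length - 1, by have := j.2; lia⟩ := by
        ext
        simp only
        lia
      rw [h1, h2]
      have hne : w ≠ [] := List.ne_nil_of_length_pos j.pos
      refine hc _ ?_ _ ?_
      · rw [List.getLast?_eq_some_getLast hne, List.getLast_eq_getElem hne]
        rfl
      · rw [List.head?_eq_some_head hne, List.head_eq_getElem hne]
        rfl
  have h1 : (w.get j).1 = (w.get (finRotate _ j)).1 := by
    rw [h]
    rfl
  have h2 := congrArg Prod.snd h
  rw [key h1] at h2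
  simp [Letter.bar] at h2

section Whitehead

variable {n : ℕ} {U : List (FreeGroup (Fin n))}

theorem WhiteheadEdge.next_prev (e : WhiteheadEdge U) : e.prev.next = e := by
  exact congrArg (Sigma.mk e.1) (Equiv.apply_symm_apply _ e.2)

theorem WhiteheadEdge.prev_next (e : WhiteheadEdge U) : e.next.prev = e := by
  exact congrArg (Sigma.mk e.1) (Equiv.symm_apply_apply _ e.2)

theorem WhiteheadEdge.secondLetter_prev (e : WhiteheadEdge U) :
    e.prev.secondLetter = e.firstLetter := by
  rw [WhiteheadEdge.secondLetter, WhiteheadEdge.next_prev]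

theorem WhiteheadEdge.firstLetter_next (e : WhiteheadEdge U) :
    e.next.firstLetter = e.secondLetter := rfl

theorem WhiteheadEdge.firstLetter_ne (hU : ∀ u ∈ U, FreeGroup.IsCyclicallyReduced u.toWord)
    (e : WhiteheadEdge U) : e.firstLetter ≠ e.secondLetter.bar :=
  get_ne_bar_get_finRotate (hU _ (List.get_mem _ _)) e.2

theorem whiteheadGraph_inc {e : WhiteheadEdge U} {v : Letter n} :
    (whiteheadGraph U).Inc e v ↔ v = e.firstLetter ∨ v = e.secondLetter.bar := by
  constructor
  · rintro ⟨y, ⟨h, -⟩ | ⟨h, -⟩⟩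
    exacts [Or.inl h, Or.inr h]
  · rintro (h | h)
    exacts [⟨_, Or.inl ⟨h, rfl⟩⟩, ⟨_, Or.inr ⟨h, rfl⟩⟩]

theorem connectingMap_secondLetter (e : WhiteheadEdge U) :
    connectingMap U e.secondLetter.bar e = e.next := if_pos rfl

/-- Without loops the two ends of an edge differ, so the `else` branch of `connectingMap` is taken
here. -/
theorem connectingMap_firstLetter (hU : ∀ u ∈ U, FreeGroup.IsCyclicallyReduced u.toWord)
    (e : WhiteheadEdge U) : connectingMap U e.firstLetter e = e.prev :=
  if_neg (e.firstLetter_ne hU)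

theorem inc_connectingMap (hU : ∀ u ∈ U, FreeGroup.IsCyclicallyReduced u.toWord)
    {e : WhiteheadEdge U} {v : Letter n} (h : (whiteheadGraph U).Inc e v) :
    (whiteheadGraph U).Inc (connectingMap U v e) v.bar := by
  rw [whiteheadGraph_inc] at *
  rcases h with rfl | rfl
  · rw [connectingMap_firstLetter hU, WhiteheadEdge.secondLetter_prev]
    exact Or.inr rfl
  · rw [connectingMap_secondLetter, Letter.bar_bar]
    exact Or.inl rfl

theorem connectingMap_connectingMap (hU : ∀ u ∈ U, FreeGroup.IsCyclicallyReduced u.toWord)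
    {e : WhiteheadEdge U} {v : Letter n} (h : (whiteheadGraph U).Inc e v) :
    connectingMap U v.bar (connectingMap U v e) = e := by
  rw [whiteheadGraph_inc] at h
  rcases h with rfl | rfl
  · rw [connectingMap_firstLetter hU, ← WhiteheadEdge.secondLetter_prev,
      connectingMap_secondLetter, WhiteheadEdge.next_prev]
  · rw [connectingMap_secondLetter, Letter.bar_bar, ← WhiteheadEdge.firstLetter_next,
      connectingMap_firstLetter hU, WhiteheadEdge.prev_next]

theorem connectingMap_injOn (hU : ∀ u ∈ U, FreeGroup.IsCyclicallyReduced u.toWord)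
    (v : Letter n) : Set.InjOn (connectingMap U v) {e | (whiteheadGraph U).Inc e v} := by
  intro e he f hf h
  rw [← connectingMap_connectingMap hU he, h, connectingMap_connectingMap hU hf]

theorem whiteheadGraph_not_isLoopAt (hU : ∀ u ∈ U, FreeGroup.IsCyclicallyReduced u.toWord)
    (e : WhiteheadEdge U) (v : Letter n) : ¬ (whiteheadGraph U).IsLoopAt e v := by
  rintro (⟨h, h'⟩ | ⟨h, h'⟩)
  · exact e.firstLetter_ne hU (h.symm.trans h')
  · exact e.firstLetter_ne hU (h'.symm.trans h)

/-- In a subgraph of the Whitehead graph, which has no loops, the degree of a vertex is the number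
of edges incident with it. -/
theorem degree_eq_ncard (hU : ∀ u ∈ U, FreeGroup.IsCyclicallyReduced u.toWord)
    {C : Graph (Letter n) (WhiteheadEdge U)} (hC : C ≤ whiteheadGraph U) (v : Letter n) :
    degree C v = {e | e ∈ C.edgeSet ∧ (whiteheadGraph U).Inc e v}.ncard := by
  have hloop : ∀ e v, ¬ C.IsLoopAt e v := fun e v h =>
    whiteheadGraph_not_isLoopAt hU e v (Graph.IsLink.mono hC h)
  have h1 : {e | C.IsLoopAt e v} = ∅ := by
    ext e
    simpa using hloop e v
  have h2 : {e | C.IsNonloopAt e v} = {e | e ∈ C.edgeSet ∧ (whiteheadGraph U).Inc e v} := by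
    ext e
    constructor
    · rintro ⟨y, -, h⟩
      exact ⟨h.edge_mem, y, Graph.IsLink.mono hC h⟩
    · rintro ⟨h, y, hy⟩
      have hy' : C.IsLink e v y := (Graph.IsSubgraph.isLink_iff hC h).2 hy
      exact ⟨y, by rintro rfl; exact hloop e _ hy', hy'⟩
  rw [degree, h1, h2]
  simp

end Whitehead

/-! ### Side-pairings -/

namespace Disks

variable {P : Disks}

theorem reverse_reverse (d : P.Dart) : reverse (reverse d) = d := by
  simp [reverse]

/-- The next corner along the boundary of the same disk. -/
def rotate (c : P.Corner) : P.Corner := ⟨c.1, finRotate _ c.2⟩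

theorem eq_of_source_eq {d : P.Dart} {c : P.Corner} (h : source d = c) :
    d = (c, true) ∨ ∃ c', rotate c' = c ∧ d = (c', false) := by
  obtain ⟨s, b⟩ := d
  cases b
  · exact Or.inr ⟨s, h, rfl⟩
  · subst h
    exact Or.inl rfl

theorem exists_rotate_eq (c : P.Corner) : ∃ c', rotate c' = c :=
  ⟨⟨c.1, (finRotate _).symm c.2⟩, by simp only [rotate, Equiv.apply_symm_apply]⟩

theorem rotate_injective : Function.Injective (rotate (P := P)) := by
  rintro ⟨i, j⟩ ⟨i', j'⟩ h
  obtain rfl : i = i' := congrArg Sigma.fst h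
  simpa [rotate, -finRotate_apply] using h

end Disks

namespace SidePairing

variable {P : Disks} (S : SidePairing P)

theorem glue_glue (d : P.Dart) : S.glue (S.glue d) = d := by
  obtain ⟨s, b⟩ := d
  simp only [glue, S.mate_mate, S.reverses_mate]
  cases S.reverses s <;> simp

theorem glue_reverse (d : P.Dart) : S.glue (Disks.reverse d) = Disks.reverse (S.glue d) := by
  by_cases h : S.reverses d.1 = true <;> simp [glue, Disks.reverse, h]

theorem glue_ne (d : P.Dart) : S.glue d ≠ d := fun h => S.mate_ne d.1 (congrArg Prod.fst h)

theorem vertex_source_glue (d : P.Dart) :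
    S.vertex (Disks.source (S.glue d)) = S.vertex (Disks.source d) :=
  (Quot.sound ⟨d, rfl, rfl⟩).symm

instance : Finite S.Vertex := Quot.finite _

instance : Finite S.Edge := Quot.finite _

/-- `mate` is an involution without fixed points, so the generated equivalence relation has the
classes `{s, S.mate s}`. -/
theorem two_mul_card_edge : 2 * Nat.card S.Edge = Nat.card P.Side := by
  classical
  let r : Setoid P.Side :=
    { r := fun s t => t = s ∨ t = S.mate s
      iseqv := by
        refine ⟨fun s => Or.inl rfl, ?_, ?_⟩
        · rintro s t (rfl | rfl)
          · exact Or.inl rfl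
          · exact Or.inr (S.mate_mate s).symm
        · rintro s t u (rfl | rfl) (rfl | rfl)
          · exact Or.inl rfl
          · exact Or.inr rfl
          · exact Or.inr rfl
          · exact Or.inl (S.mate_mate s) }
  have hiff : ∀ s t : P.Side, (Quot.mk _ s : S.Edge) = Quot.mk _ t ↔ t = s ∨ t = S.mate s := by
    intro s t
    constructor
    · intro h
      exact (Setoid.eqvGen_le (s := r) (fun _ _ h => Or.inr h)) (Quot.eqvGen_exact h)
    · rintro (rfl | h)
      · rfl
      · exact Quot.sound h
  have : Fintype S.Edge := Fintype.ofFinite _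
  rw [Nat.card_eq_fintype_card, Nat.card_eq_fintype_card]
  let q : P.Side → S.Edge := Quot.mk _
  have h := Finset.card_eq_sum_card_fiberwise (s := (Finset.univ : Finset P.Side))
    (t := (Finset.univ : Finset S.Edge)) (f := q) (fun _ _ => Finset.mem_coe.2 (Finset.mem_univ _))
  rw [Finset.card_univ] at h
  rw [h, Finset.sum_const_nat (m := 2), Finset.card_univ, mul_comm]
  intro x _
  obtain ⟨s, rfl⟩ : ∃ s, q s = x := Quot.exists_rep x
  have : (Finset.univ.filter fun t : P.Side => q t = q s) = {s, S.mate s} := by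
    ext t
    simp only [Finset.mem_filter, Finset.mem_univ, true_and, Finset.mem_insert,
      Finset.mem_singleton]
    rw [eq_comm]
    exact hiff s t
  exact this ▸ Finset.card_pair (S.mate_ne s).symm

theorem eulerChar_lt_iff : S.eulerChar < (P.num : ℤ) ↔ 2 * Nat.card S.Vertex < Nat.card P.Side := by
  rw [← S.two_mul_card_edge, eulerChar]
  lia

end SidePairing

end Polygonality

namespace Polygonality

/-! ### Cycles from polygonal surfaces -/

section Links

variable {n : ℕ} {U : List (FreeGroup (Fin n))} {P : Disks} {S : SidePairing P}

/-- A labelling of the corners of the disks by edges of the Whitehead graph: a corner between an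
incoming side that reads `x` and an outgoing side that reads `y` is labelled by an edge joining
`x` and `y⁻¹`, and labels of successive corners are related by the connecting maps. -/
structure CornerLabelling (U : List (FreeGroup (Fin n))) (φ : S.RoseMap n) where
  /-- The label of a corner. -/
  edge : P.Corner → WhiteheadEdge U
  inc : ∀ d, (whiteheadGraph U).Inc (edge (Disks.source d)) (φ.letter d).bar
  exists_dart : ∀ c v, (whiteheadGraph U).Inc (edge c) v →
    ∃ d, Disks.source d = c ∧ (φ.letter d).bar = v
  connectingMap_edge : ∀ d, connectingMap U (φ.letter d).bar (edge (Disks.source d)) =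
    edge (Disks.source (Disks.reverse d))
  dart_ext : ∀ d d', Disks.source d = Disks.source d' → φ.letter d = φ.letter d' → d = d'

theorem letter_false (φ : S.RoseMap n) (c : P.Corner) :
    φ.letter (c, false) = (φ.letter (c, true)).bar :=
  φ.letter_reverse (c, true)

theorem CornerLabelling.nonempty_of_isLink
    (hU : ∀ u ∈ U, FreeGroup.IsCyclicallyReduced u.toWord) (φ : S.RoseMap n)
    (E : P.Corner → WhiteheadEdge U)
    (hE : ∀ c, (whiteheadGraph U).IsLink (E (Disks.rotate c)) (φ.letter (c, true))
      (φ.letter (Disks.rotate c, true)).bar)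
    (hσ : ∀ c, connectingMap U (φ.letter (c, true)).bar (E c) = E (Disks.rotate c)) :
    Nonempty (CornerLabelling U φ) := by
  have hinc : ∀ c, (whiteheadGraph U).Inc (E c) (φ.letter (c, true)).bar := fun c => by
    obtain ⟨c, rfl⟩ := Disks.exists_rotate_eq c
    exact (hE c).inc_right
  have hne : ∀ c, φ.letter (Disks.rotate c, true) ≠ φ.letter (c, false) := fun c h => by
    have h1 := hE c
    rw [h, letter_false, Letter.bar_bar] at h1
    exact whiteheadGraph_not_isLoopAt hU _ _ h1
  refine ⟨⟨E, ?_, ?_, ?_, ?_⟩⟩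
  · rintro ⟨c, _ | _⟩
    · rw [letter_false, Letter.bar_bar]
      exact (hE c).inc_left
    · exact hinc c
  · intro c v h
    obtain ⟨c, rfl⟩ := Disks.exists_rotate_eq c
    rcases h.eq_or_eq_of_isLink (hE c) with rfl | rfl
    · exact ⟨(c, false), rfl, by rw [letter_false, Letter.bar_bar]⟩
    · exact ⟨(Disks.rotate c, true), rfl, rfl⟩
  · rintro ⟨c, _ | _⟩
    · rw [letter_false, Letter.bar_bar]
      have := connectingMap_connectingMap hU (hinc c)
      rw [Letter.bar_bar, hσ] at this
      exact this
    · exact hσ c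
  · intro d d' h hl
    obtain ⟨c₀, h₀⟩ : ∃ c, Disks.source d = c := ⟨_, rfl⟩
    rw [h₀] at h
    rcases Disks.eq_of_source_eq h₀ with rfl | ⟨c, hc, rfl⟩ <;>
      rcases Disks.eq_of_source_eq h.symm with rfl | ⟨c', hc', rfl⟩
    · rfl
    · rw [← hc'] at hl
      exact absurd hl (hne c')
    · rw [← hc] at hl
      exact absurd hl.symm (hne c)
    · rw [Disks.rotate_injective (hc.trans hc'.symm)]

theorem CornerLabelling.nonempty
    (hU : ∀ u ∈ U, FreeGroup.IsCyclicallyReduced u.toWord) (φ : S.RoseMap n)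
    (h : ∀ i : Fin P.num, ∃ u ∈ U, ∃ k : ℤ, k ≠ 0 ∧
      (φ.boundaryWord i).IsRotated (u ^ k).toWord) :
    Nonempty (CornerLabelling U φ) := by
  have key : ∀ i : Fin P.num, ∃ E : Fin (P.sides i) → WhiteheadEdge U,
      (∀ j, (whiteheadGraph U).IsLink (E (finRotate _ j)) (φ.letter (⟨i, j⟩, true))
        (φ.letter (⟨i, finRotate _ j⟩, true)).bar) ∧
      ∀ j, connectingMap U (φ.letter (⟨i, j⟩, true)).bar (E j) = E (finRotate _ j) := by
    intro i
    obtain ⟨u, hu, k, -, hk⟩ := h i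
    obtain ⟨w, rfl⟩ := List.get_of_mem hu
    obtain ⟨π, ⟨h1, h2⟩ | ⟨h1, h2⟩⟩ :=
      exists_semiconj_of_isRotated_zpow (hU _ hu) k _ (P.sides_pos i) _ hk
    · let e : Fin (P.sides i) → WhiteheadEdge U := fun j => ⟨w, π j⟩
      have hnext : ∀ j, e (finRotate _ j) = (e j).next := fun j =>
        congrArg (Sigma.mk w) (h1 j)
      have hfirst : ∀ j, (e j).firstLetter = φ.letter (⟨i, j⟩, true) := fun j => (h2 j).symm
      have hsecond : ∀ j, (e j).prev.secondLetter = φ.letter (⟨i, j⟩, true) := fun j => by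
        rw [WhiteheadEdge.secondLetter_prev, hfirst]
      -- Corner `j` is where side `j` begins, so its label starts with the letter of side `j - 1`.
      -- When the word is read backwards, below, no such shift occurs.
      refine ⟨fun j => (e j).prev, fun j => Or.inl ⟨?_, ?_⟩, fun j => ?_⟩
      · simp only [hnext, WhiteheadEdge.prev_next, hfirst]
      · rw [hsecond]
      · simp only [hnext, WhiteheadEdge.prev_next]
        rw [← hsecond, connectingMap_secondLetter, WhiteheadEdge.next_prev]
    · let e : Fin (P.sides i) → WhiteheadEdge U := fun j => ⟨w, π j⟩
      have hprev : ∀ j, e (finRotate _ j) = (e j).prev := fun j =>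
        congrArg (Sigma.mk w) (h1 j)
      have hfirst : ∀ j, (e j).firstLetter.bar = φ.letter (⟨i, j⟩, true) := fun j => (h2 j).symm
      refine ⟨e, fun j => Or.inr ⟨?_, ?_⟩, fun j => ?_⟩
      · rw [hprev, WhiteheadEdge.secondLetter_prev, hfirst]
      · rw [← hfirst, Letter.bar_bar]
      · rw [← hfirst, Letter.bar_bar, connectingMap_firstLetter hU, hprev]
  choose E hE hσ using key
  exact CornerLabelling.nonempty_of_isLink hU φ (fun c => E c.1 c.2) (fun c => hE c.1 c.2)
    fun c => hσ c.1 c.2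

/-! ### Links of vertices as cycles in the Whitehead graph. -/

namespace CornerLabelling

variable {φ : S.RoseMap n} (lab : CornerLabelling U φ)

/-- The image in the Whitehead graph of the link of a vertex of the surface. -/
def link (p : S.Vertex) : Graph (Letter n) (WhiteheadEdge U) where
  vertexSet := {v | ∃ d, S.vertex (Disks.source d) = p ∧ (φ.letter d).bar = v}
  edgeSet := {e | ∃ c, S.vertex c = p ∧ lab.edge c = e}
  IsLink e x y := (∃ c, S.vertex c = p ∧ lab.edge c = e) ∧ (whiteheadGraph U).IsLink e x y
  isLink_symm := fun _ _ => ⟨fun _ _ h => ⟨h.1, h.2.symm⟩⟩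
  eq_or_eq_of_isLink_of_isLink := fun _ _ _ _ _ h h' => h.2.left_eq_or_eq h'.2
  edge_mem_iff_exists_isLink := fun _ =>
    ⟨fun h => ⟨_, _, h, Or.inl ⟨rfl, rfl⟩⟩, fun ⟨_, _, h, _⟩ => h⟩
  left_mem_of_isLink := by
    rintro e x y ⟨⟨c, hc, rfl⟩, h⟩
    obtain ⟨d, rfl, hd⟩ := lab.exists_dart c x h.inc_left
    exact ⟨d, hc, hd⟩

theorem link_le (p : S.Vertex) : lab.link p ≤ whiteheadGraph U :=
  ⟨fun _ _ => Set.mem_univ _, fun _ _ _ h => h.2⟩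

theorem edge_mem_link (d : P.Dart) :
    lab.edge (Disks.source d) ∈ (lab.link (S.vertex (Disks.source d))).edgeSet :=
  ⟨_, rfl, rfl⟩

theorem edge_glue_mem_link (d : P.Dart) :
    lab.edge (Disks.source (S.glue d)) ∈ (lab.link (S.vertex (Disks.source d))).edgeSet :=
  ⟨_, S.vertex_source_glue d, rfl⟩

theorem reflTransGen_adj_of_source_eq (d d' : P.Dart) (h : Disks.source d = Disks.source d') :
    Relation.ReflTransGen (lab.link (S.vertex (Disks.source d))).Adj
      (φ.letter d).bar (φ.letter d').bar := by
  by_cases hl : (φ.letter d).bar = (φ.letter d').bar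
  · rw [hl]
  · obtain ⟨y, hy⟩ := lab.inc d
    have h' := lab.inc d'
    rw [← h] at h'
    rw [h'.eq_of_isLink_of_ne_left hy (Ne.symm hl)]
    exact .single ⟨_, lab.edge_mem_link d, hy⟩

/-- Gluing does not change the letter, and the two oriented sides leaving one corner give the two
ends of its label. So a chain of identifications between corners becomes a path in the link. -/
theorem reflTransGen_adj (d d' : P.Dart)
    (h : S.vertex (Disks.source d) = S.vertex (Disks.source d')) :
    Relation.ReflTransGen (lab.link (S.vertex (Disks.source d))).Adj
      (φ.letter d).bar (φ.letter d').bar := by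
  have key : ∀ c c' : P.Corner, Relation.EqvGen
      (fun p q : P.Corner => ∃ d : P.Dart, p = Disks.source d ∧ q = Disks.source (S.glue d)) c c' →
      ∀ d d', Disks.source d = c → Disks.source d' = c' →
      Relation.ReflTransGen (lab.link (S.vertex c)).Adj (φ.letter d).bar (φ.letter d').bar := by
    intro c c' hcc
    induction hcc with
    | rel c c' h =>
      obtain ⟨d₀, rfl, rfl⟩ := h
      intro d d' h h'
      have h1 := lab.reflTransGen_adj_of_source_eq d d₀ h
      have h2 := lab.reflTransGen_adj_of_source_eq (S.glue d₀) d' h'.symm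
      rw [S.vertex_source_glue, φ.letter_glue] at h2
      rw [h] at h1
      exact h1.trans h2
    | refl c =>
      rintro d d' rfl h'
      exact lab.reflTransGen_adj_of_source_eq d d' h'.symm
    | symm c c' hcc ih =>
      intro d d' h h'
      have hv : S.vertex c = S.vertex c' := Quot.eqvGen_sound hcc
      rw [← hv]
      exact Std.Symm.symm _ _ (ih d' d h' h)
    | trans c₁ c₂ c₃ h₁₂ h₂₃ ih₁ ih₂ =>
      intro d d' h h'
      have hv : S.vertex c₁ = S.vertex c₂ := Quot.eqvGen_sound h₁₂
      have h2 := ih₂ (c₂, true) d' rfl h'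
      rw [← hv] at h2
      exact (ih₁ d (c₂, true) h rfl).trans h2
  exact key _ _ (Quot.eqvGen_exact h) d d' rfl rfl

theorem link_connected (p : S.Vertex) : Connected (lab.link p) := by
  constructor
  · obtain ⟨c, rfl⟩ := Quot.exists_rep p
    exact ⟨_, (c, true), rfl, rfl⟩
  · rintro _ ⟨d, rfl, rfl⟩ _ ⟨d', hd', rfl⟩
    exact lab.reflTransGen_adj d d' hd'.symm

/-- By local injectivity only `d` and `S.glue d` leave this vertex with the letter of `d`. -/
theorem link_edges_at (hφ : φ.IsImmersion) (d : P.Dart) :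
    {e | e ∈ (lab.link (S.vertex (Disks.source d))).edgeSet ∧
      (whiteheadGraph U).Inc e (φ.letter d).bar} =
    {lab.edge (Disks.source d), lab.edge (Disks.source (S.glue d))} := by
  ext e
  constructor
  · rintro ⟨⟨c, hc, rfl⟩, h⟩
    obtain ⟨d', rfl, hd'⟩ := lab.exists_dart c _ h
    rcases hφ d d' hc.symm (Letter.bar_injective hd').symm with rfl | rfl
    · exact Or.inl rfl
    · exact Or.inr rfl
  · rintro (rfl | rfl)
    · exact ⟨lab.edge_mem_link d, lab.inc d⟩
    · refine ⟨lab.edge_glue_mem_link d, ?_⟩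
      have := lab.inc (S.glue d)
      rwa [φ.letter_glue] at this

/-- A vertex of the surface whose link has length two and is folded to a single edge has just two
corners. -/
theorem eq_or_eq_of_edge_eq (hφ : φ.IsImmersion) (d : P.Dart)
    (hd : lab.edge (Disks.source d) = lab.edge (Disks.source (S.glue d)))
    (c : P.Corner) (hc : S.vertex c = S.vertex (Disks.source d)) :
    c = Disks.source d ∨ c = Disks.source (S.glue d) := by
  have hne : Disks.source d ≠ Disks.source (S.glue d) := fun h =>
    S.glue_ne d (lab.dart_ext _ _ h (φ.letter_glue d).symm).symm
  have closed : ∀ d₁ : P.Dart,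
      Disks.source d₁ = Disks.source d ∨ Disks.source d₁ = Disks.source (S.glue d) →
      Disks.source (S.glue d₁) = Disks.source d ∨
        Disks.source (S.glue d₁) = Disks.source (S.glue d) := by
    -- Equal labels offer the same outgoing letters at both corners, so local injectivity forces
    -- each side leaving one to be glued to a side leaving the other. The two corners thus form a
    -- closed class.
    have aux : ∀ (c₀ c₁ : P.Corner) (d₁ : P.Dart), c₀ ≠ c₁ → lab.edge c₀ = lab.edge c₁ →
        S.vertex c₀ = S.vertex c₁ → Disks.source d₁ = c₀ → Disks.source (S.glue d₁) = c₁ := by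
      rintro c₀ c₁ d₁ hcc he hv rfl
      obtain ⟨d₂, rfl, h2⟩ := lab.exists_dart c₁ _ (he ▸ lab.inc d₁)
      rcases hφ d₁ d₂ hv (Letter.bar_injective h2).symm with rfl | rfl
      · exact absurd rfl hcc
      · rfl
    rintro d₁ (h | h)
    · exact Or.inr (aux _ _ d₁ hne hd (S.vertex_source_glue d).symm h)
    · exact Or.inl (aux _ _ d₁ hne.symm hd.symm (S.vertex_source_glue d) h)
  have key : ∀ c c' : P.Corner, Relation.EqvGen
      (fun p q : P.Corner => ∃ d : P.Dart, p = Disks.source d ∧ q = Disks.source (S.glue d)) c c' →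
      ((c = Disks.source d ∨ c = Disks.source (S.glue d)) ↔
        (c' = Disks.source d ∨ c' = Disks.source (S.glue d))) := by
    intro c c' h
    induction h with
    | rel c c' h =>
      obtain ⟨d₁, rfl, rfl⟩ := h
      refine ⟨closed d₁, fun h => ?_⟩
      have := closed _ h
      rwa [S.glue_glue] at this
    | refl => rfl
    | symm _ _ _ ih => exact ih.symm
    | trans _ _ _ _ _ ih₁ ih₂ => exact ih₁.trans ih₂
  exact (key _ _ (Quot.eqvGen_exact hc)).2 (Or.inl rfl)

/-- The link of a vertex is embedded in the Whitehead graph, rather than folded to an edge. -/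
def Embedded (p : S.Vertex) : Prop :=
  ∀ d, S.vertex (Disks.source d) = p →
    lab.edge (Disks.source d) ≠ lab.edge (Disks.source (S.glue d))

theorem ncard_corners_le_two (hφ : φ.IsImmersion) (p : S.Vertex) (hp : ¬ lab.Embedded p) :
    {c | S.vertex c = p}.ncard ≤ 2 := by
  simp only [Embedded, not_forall, not_not] at hp
  obtain ⟨d, rfl, hd⟩ := hp
  refine (Set.ncard_le_ncard (t := {Disks.source d, Disks.source (S.glue d)}) fun c hc => ?_).trans
    ((Set.ncard_insert_le _ _).trans (by rw [Set.ncard_singleton]))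
  exact lab.eq_or_eq_of_edge_eq hφ d hd c hc

theorem embedded_of_edge_ne (hφ : φ.IsImmersion) (d : P.Dart)
    (hd : lab.edge (Disks.source d) ≠ lab.edge (Disks.source (S.glue d))) :
    lab.Embedded (S.vertex (Disks.source d)) := by
  intro d' hd' he
  apply hd
  have h : ∀ c, S.vertex c = S.vertex (Disks.source d) →
      lab.edge c = lab.edge (Disks.source d') := fun c hc => by
    rcases lab.eq_or_eq_of_edge_eq hφ d' he c (hc.trans hd'.symm) with rfl | rfl
    · rfl
    · exact he.symm
  rw [h _ rfl, h _ (S.vertex_source_glue d)]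

theorem edge_injOn (hφ : φ.IsImmersion) (p : S.Vertex) (hp : lab.Embedded p) :
    Set.InjOn lab.edge {c | S.vertex c = p} := by
  intro c hc c' hc' he
  by_contra hne
  obtain ⟨d, rfl, hd⟩ := lab.exists_dart c' _ (he ▸ lab.inc (c, true))
  rcases hφ (c, true) d (hc.trans hc'.symm) (Letter.bar_injective hd).symm with rfl | rfl
  · exact hne rfl
  · exact hp (c, true) hc he

theorem link_isCycle (hφ : φ.IsImmersion)
    (hU : ∀ u ∈ U, FreeGroup.IsCyclicallyReduced u.toWord) (p : S.Vertex)
    (hp : lab.Embedded p) : IsCycle (lab.link p) where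
  finite_vertexSet := Set.toFinite _
  finite_edgeSet := Set.toFinite _
  connected := lab.link_connected p
  degree_eq_two := by
    rintro _ ⟨d, rfl, rfl⟩
    rw [degree_eq_ncard hU (lab.link_le _), lab.link_edges_at hφ]
    exact Set.ncard_pair (hp d rfl)

theorem cycleLength_link (hφ : φ.IsImmersion) (p : S.Vertex) (hp : lab.Embedded p) :
    cycleLength (lab.link p) = {c | S.vertex c = p}.ncard :=
  (lab.edge_injOn hφ p hp).ncard_image

/-- Each vertex `p` counted on the left has an outgoing edge with inverse letter `v`; send `p` to
the other end of that edge. Local injectivity at the far end recovers the edge, so this is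
injective. The reverse inequality is the same statement at `v.bar`. -/
theorem ncard_embedded_le (hφ : φ.IsImmersion)
    (hU : ∀ u ∈ U, FreeGroup.IsCyclicallyReduced u.toWord)
    (v : Letter n) (e f : WhiteheadEdge U) (he : (whiteheadGraph U).Inc e v)
    (hf : (whiteheadGraph U).Inc f v) :
    {p | lab.Embedded p ∧ e ∈ (lab.link p).edgeSet ∧ f ∈ (lab.link p).edgeSet}.ncard ≤
    {p | lab.Embedded p ∧ connectingMap U v e ∈ (lab.link p).edgeSet ∧
      connectingMap U v f ∈ (lab.link p).edgeSet}.ncard := by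
  have key : ∀ p ∈ {p | lab.Embedded p ∧ e ∈ (lab.link p).edgeSet ∧ f ∈ (lab.link p).edgeSet},
      ∃ q, q ∈ {p | lab.Embedded p ∧ connectingMap U v e ∈ (lab.link p).edgeSet ∧
        connectingMap U v f ∈ (lab.link p).edgeSet} ∧
      ∃ d, S.vertex (Disks.source d) = p ∧ (φ.letter d).bar = v ∧
        S.vertex (Disks.source (Disks.reverse d)) = q := by
    rintro p ⟨hp, heE, hfE⟩
    obtain ⟨c, rfl, rfl⟩ := heE
    obtain ⟨d, rfl, rfl⟩ := lab.exists_dart c _ he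
    have hglue : connectingMap U (φ.letter d).bar (lab.edge (Disks.source (S.glue d))) =
        lab.edge (Disks.source (S.glue (Disks.reverse d))) := by
      rw [S.glue_reverse, ← lab.connectingMap_edge, φ.letter_glue]
    have hmem : ∀ g, g ∈ (lab.link (S.vertex (Disks.source d))).edgeSet →
        (whiteheadGraph U).Inc g (φ.letter d).bar → connectingMap U (φ.letter d).bar g ∈
          (lab.link (S.vertex (Disks.source (Disks.reverse d)))).edgeSet := by
      intro g hg hg'
      have h : g ∈ ({lab.edge (Disks.source d), lab.edge (Disks.source (S.glue d))} : Set _) :=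
        lab.link_edges_at hφ d ▸ ⟨hg, hg'⟩
      rcases h with rfl | rfl
      · rw [lab.connectingMap_edge]
        exact lab.edge_mem_link _
      · rw [hglue]
        exact lab.edge_glue_mem_link _
    refine ⟨_, ⟨?_, hmem _ (lab.edge_mem_link d) he, hmem _ hfE hf⟩, d, rfl, rfl, rfl⟩
    -- Folding at the far end would, by injectivity of the connecting map, mean folding at `p`.
    refine lab.embedded_of_edge_ne hφ _ fun h => hp d rfl ?_
    rw [← lab.connectingMap_edge, ← hglue] at h
    have hinc := lab.inc (S.glue d)
    rw [φ.letter_glue] at hinc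
    exact connectingMap_injOn hU _ (lab.inc d) hinc h
  rcases Set.eq_empty_or_nonempty
    {p | lab.Embedded p ∧ e ∈ (lab.link p).edgeSet ∧ f ∈ (lab.link p).edgeSet} with h | ⟨p₀, hp₀⟩
  · rw [h, Set.ncard_empty]
    exact Nat.zero_le _
  have : Nonempty S.Vertex := ⟨p₀⟩
  have : Nonempty P.Dart := let ⟨_, _, d, _⟩ := key p₀ hp₀; ⟨d⟩
  choose! q hq d hd using key
  refine Set.ncard_le_ncard_of_injOn q hq fun p hp p' hp' h => ?_
  obtain ⟨h1, h2, h3⟩ := hd p hp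
  obtain ⟨h1', h2', h3'⟩ := hd p' hp'
  have hl : φ.letter (Disks.reverse (d p)) = φ.letter (Disks.reverse (d p')) := by
    rw [φ.letter_reverse, φ.letter_reverse, h2, h2']
  rcases hφ _ _ (h3.trans (h.trans h3'.symm)) hl with hr | hr
  · have := congrArg Disks.reverse hr
    rw [Disks.reverse_reverse, Disks.reverse_reverse] at this
    rw [← h1, ← h1', this]
  · have := congrArg Disks.reverse hr
    rw [S.glue_reverse, Disks.reverse_reverse, Disks.reverse_reverse] at this
    rw [← h1, ← h1', this, S.vertex_source_glue]

theorem ncard_embedded_eq (hφ : φ.IsImmersion)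
    (hU : ∀ u ∈ U, FreeGroup.IsCyclicallyReduced u.toWord)
    (v : Letter n) (e f : WhiteheadEdge U) (he : (whiteheadGraph U).Inc e v)
    (hf : (whiteheadGraph U).Inc f v) :
    {p | lab.Embedded p ∧ e ∈ (lab.link p).edgeSet ∧ f ∈ (lab.link p).edgeSet}.ncard =
    {p | lab.Embedded p ∧ connectingMap U v e ∈ (lab.link p).edgeSet ∧
      connectingMap U v f ∈ (lab.link p).edgeSet}.ncard := by
  refine le_antisymm (lab.ncard_embedded_le hφ hU v e f he hf) ?_
  have := lab.ncard_embedded_le hφ hU v.bar _ _ (inc_connectingMap hU he) (inc_connectingMap hU hf)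
  rwa [connectingMap_connectingMap hU he, connectingMap_connectingMap hU hf] at this

end CornerLabelling

theorem exists_cycles_of_isPolygonal (hU : ∀ u ∈ U, FreeGroup.IsCyclicallyReduced u.toWord)
    (h : IsPolygonal U) :
    ∃ (t : ℕ) (C : Fin t → Graph (Letter n) (WhiteheadEdge U)),
      0 < t ∧
      (∀ k, C k ≤ whiteheadGraph U ∧ IsCycle (C k)) ∧
      (∃ k, 3 ≤ cycleLength (C k)) ∧
      ∀ (v : Letter n) (e f : WhiteheadEdge U),
        (whiteheadGraph U).Inc e v → (whiteheadGraph U).Inc f v →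
        {k | e ∈ (C k).edgeSet ∧ f ∈ (C k).edgeSet}.ncard =
          {k | connectingMap U v e ∈ (C k).edgeSet ∧
            connectingMap U v f ∈ (C k).edgeSet}.ncard := by
  classical
  obtain ⟨P, S, φ, hφ, hread, hχ⟩ := h
  obtain ⟨lab⟩ := CornerLabelling.nonempty hU φ hread
  obtain ⟨t, ⟨g⟩⟩ := Finite.exists_equiv_fin {p // lab.Embedded p}
  -- Pigeonhole: there are more than twice as many corners as vertices.
  obtain ⟨p, hp⟩ : ∃ p, 2 < {c | S.vertex c = p}.ncard := by
    have : Fintype S.Vertex := Fintype.ofFinite _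
    rw [S.eulerChar_lt_iff, Nat.card_eq_fintype_card, Nat.card_eq_fintype_card, mul_comm] at hχ
    obtain ⟨p, hp⟩ := Fintype.exists_lt_card_fiber_of_mul_lt_card S.vertex hχ
    refine ⟨p, ?_⟩
    rwa [← Set.ncard_coe_finset, Finset.coe_filter_univ] at hp
  have hemb : lab.Embedded p := by
    by_contra hemb
    have := lab.ncard_corners_le_two hφ p hemb
    lia
  have hcount : ∀ Q : S.Vertex → Prop,
      {k | Q (g.symm k).1}.ncard = {p | lab.Embedded p ∧ Q p}.ncard := fun Q => by
    rw [← Set.ncard_image_of_injective _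
      (Subtype.val_injective.comp g.symm.injective)]
    congr 1
    ext p
    constructor
    · rintro ⟨k, hk, rfl⟩
      exact ⟨(g.symm k).2, hk⟩
    · rintro ⟨hp, hQ⟩
      exact ⟨g ⟨p, hp⟩, by simpa using hQ, by simp⟩
  refine ⟨t, fun k => lab.link (g.symm k).1, (g ⟨p, hemb⟩).pos, fun k =>
    ⟨lab.link_le _, lab.link_isCycle hφ hU _ (g.symm k).2⟩, ⟨g ⟨p, hemb⟩, ?_⟩,
    fun v e f he hf => ?_⟩
  · simp only [Equiv.symm_apply_apply]
    rw [lab.cycleLength_link hφ p hemb]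
    exact hp
  · rw [hcount fun p => e ∈ (lab.link p).edgeSet ∧ f ∈ (lab.link p).edgeSet,
      hcount fun p => connectingMap U v e ∈ (lab.link p).edgeSet ∧
        connectingMap U v f ∈ (lab.link p).edgeSet]
    exact lab.ncard_embedded_eq hφ hU v e f he hf

end Links

end Polygonality

/-! ### Realizing permutations by disks and side-pairings. -/

/-- All fibres but one have matching sizes, and since `X` is finite the last one is what remains. In
the application `z₀` is the empty set, the value at cycles that miss a given vertex. -/
theorem exists_perm_of_ncard_fiber_eq {X Z : Type*} [Finite X] (f g : X → Z) (z₀ : Z)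
    (h : ∀ z ≠ z₀, {x | f x = z}.ncard = {x | g x = z}.ncard) :
    ∃ e : Equiv.Perm X, ∀ x, g (e x) = f x := by
  classical
  have : Fintype X := Fintype.ofFinite X
  let T : Finset Z := insert z₀ (Finset.univ.image f ∪ Finset.univ.image g)
  have hsum : ∀ a : X → Z, (∀ x, a x ∈ T) →
      {x | a x = z₀}.ncard + ∑ z ∈ T.erase z₀, {x | a x = z}.ncard = Fintype.card X := by
    intro a ha
    rw [Finset.add_sum_erase T (fun z => {x | a x = z}.ncard) (Finset.mem_insert_self _ _),
      ← Finset.card_univ, Finset.card_eq_sum_card_fiberwise (t := T) (f := a) (fun x _ => ha x)]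
    refine Finset.sum_congr rfl fun z _ => ?_
    rw [← Set.ncard_coe_finset, Finset.coe_filter_univ]
  have hall : ∀ z, {x | f x = z}.ncard = {x | g x = z}.ncard := by
    intro z
    by_cases hz : z = z₀
    · subst hz
      have hf := hsum f (by simp [T])
      have hg := hsum g (by simp [T])
      rw [Finset.sum_congr rfl fun w hw => h w (Finset.ne_of_mem_erase hw), ← hg] at hf
      exact Nat.add_right_cancel hf
    · exact h z hz
  have hequiv : ∀ z, Nonempty ({x // f x = z} ≃ {x // g x = z}) := fun z =>
    Finite.card_eq.1 (hall z)
  exact ⟨Equiv.ofFiberEquiv fun z => (hequiv z).some, Equiv.ofFiberEquiv_map _⟩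

namespace Polygonality

/-- Every permutation of a finite set is the rotation of the sides of polygonal disks. -/
theorem Disks.exists_equiv_of_perm {X : Type*} [Finite X] (τ : Equiv.Perm X) :
    ∃ (P : Disks) (Φ : P.Corner ≃ X), ∀ c, Φ (rotate c) = τ (Φ c) := by
  classical
  obtain ⟨m, ⟨g⟩⟩ := Finite.exists_equiv_fin (Quotient (Equiv.Perm.SameCycle.setoid τ))
  let rep : Fin m → X := fun i => (g.symm i).out
  have hrep : ∀ i, g (Quotient.mk _ (rep i)) = i := fun i => by
    simp only [rep, Quotient.out_eq, Equiv.apply_symm_apply]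
  -- One disk per orbit of `τ`, with as many sides as the orbit has elements.
  let P : Disks := ⟨m, fun i => Function.minimalPeriod τ (rep i), fun i =>
    Function.minimalPeriod_pos_of_mem_periodicPts (τ.injective.mem_periodicPts _)⟩
  let F : P.Corner → X := fun c => τ^[c.2] (rep c.1)
  have hsame : ∀ c : P.Corner, g (Quotient.mk _ (F c)) = c.1 := fun c => by
    rw [← hrep c.1]
    refine congrArg g (Quotient.sound ?_)
    refine Equiv.Perm.SameCycle.symm ⟨(c.2 : ℕ), ?_⟩
    rw [zpow_natCast, Equiv.Perm.coe_pow]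
  have hinj : Function.Injective F := by
    rintro ⟨i, k⟩ ⟨i', k'⟩ h
    obtain rfl : i = i' :=
      (hsame ⟨i, k⟩).symm.trans ((congrArg (fun x => g (Quotient.mk _ x)) h).trans (hsame ⟨i', k'⟩))
    have hk : (k : ℕ) = k' := Function.iterate_injOn_Iio_minimalPeriod k.2 k'.2 h
    rw [Fin.ext hk]
  have hsurj : Function.Surjective F := by
    intro x
    have h : Equiv.Perm.SameCycle τ (rep (g (Quotient.mk _ x))) x := by
      refine Quotient.exact (s := Equiv.Perm.SameCycle.setoid τ) (g.injective ?_)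
      rw [hrep]
    obtain ⟨j, hj⟩ := h.exists_nat_pow_eq
    refine ⟨⟨g (Quotient.mk _ x), ⟨j % Function.minimalPeriod τ _, Nat.mod_lt _ (P.sides_pos _)⟩⟩, ?_⟩
    rw [Equiv.Perm.coe_pow] at hj
    exact (Function.iterate_mod_minimalPeriod_eq).trans hj
  refine ⟨P, Equiv.ofBijective F ⟨hinj, hsurj⟩, fun c => ?_⟩
  change τ^[(finRotate _ c.2 : ℕ)] (rep c.1) = τ (τ^[c.2] (rep c.1))
  rw [coe_finRotate_eq_mod, ← Function.iterate_succ_apply' τ]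
  exact Function.iterate_mod_minimalPeriod_eq

/-- A side-pairing is determined by the involution that it induces on oriented sides. -/
theorem SidePairing.exists_glue_eq {P : Disks} (γ : P.Dart → P.Dart) (hγ : ∀ d, γ (γ d) = d)
    (hrev : ∀ d, γ (Disks.reverse d) = Disks.reverse (γ d)) (hne : ∀ d, (γ d).1 ≠ d.1) :
    ∃ S : SidePairing P, S.glue = γ := by
  have hfalse : ∀ s, γ (s, false) = Disks.reverse (γ (s, true)) := fun s => hrev (s, true)
  have key : ∀ s, γ ((γ (s, true)).1, true) = (s, (γ (s, true)).2) := by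
    intro s
    have h := hγ (s, true)
    rcases hs : γ (s, true) with ⟨s', b⟩
    rw [hs] at h
    cases b
    · rw [hfalse] at h
      have h' := congrArg Disks.reverse h
      rw [Disks.reverse_reverse] at h'
      exact h'
    · exact h
  refine ⟨⟨fun s => (γ (s, true)).1, fun s => ?_, fun s => hne (s, true),
    fun s => !(γ (s, true)).2, fun s => ?_⟩, funext ?_⟩
  · rw [key]
  · rw [key]
  · rintro ⟨s, _ | _⟩
    · rw [hfalse]
      refine Prod.ext rfl ?_
      cases h : (γ (s, true)).2 <;> simp [SidePairing.glue, Disks.reverse, h]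
    · refine Prod.ext rfl ?_
      cases h : (γ (s, true)).2 <;> simp [SidePairing.glue, h]

/-! ### Matching the cycles along connecting maps. -/

section Cycles

variable {n : ℕ} {U : List (FreeGroup (Fin n))}

theorem ncard_edges_at_cycle (hU : ∀ u ∈ U, FreeGroup.IsCyclicallyReduced u.toWord)
    {C : Graph (Letter n) (WhiteheadEdge U)} (hC : C ≤ whiteheadGraph U) (hC' : IsCycle C)
    {e : WhiteheadEdge U} {v : Letter n} (he : e ∈ C.edgeSet) (hv : (whiteheadGraph U).Inc e v) :
    {e | e ∈ C.edgeSet ∧ (whiteheadGraph U).Inc e v}.ncard = 2 := by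
  obtain ⟨y, hy⟩ := hv
  rw [← degree_eq_ncard hU hC]
  exact hC'.degree_eq_two v ((Graph.IsSubgraph.isLink_iff hC he).2 hy).left_mem

/-- A cycle through `v` has just two edges there, so the counts in the theorem are the fibre sizes
of the map from a cycle to its set of edges at `v`. -/
theorem edges_at_cycle_eq_pair_iff (hU : ∀ u ∈ U, FreeGroup.IsCyclicallyReduced u.toWord)
    {C : Graph (Letter n) (WhiteheadEdge U)} (hC : C ≤ whiteheadGraph U) (hC' : IsCycle C)
    {e f : WhiteheadEdge U} {v : Letter n} (hef : e ≠ f) (he : (whiteheadGraph U).Inc e v)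
    (hf : (whiteheadGraph U).Inc f v) :
    {e | e ∈ C.edgeSet ∧ (whiteheadGraph U).Inc e v} = {e, f} ↔
      e ∈ C.edgeSet ∧ f ∈ C.edgeSet := by
  constructor
  · intro h
    have h1 : e ∈ ({e, f} : Set (WhiteheadEdge U)) := Or.inl rfl
    have h2 : f ∈ ({e, f} : Set (WhiteheadEdge U)) := Or.inr rfl
    rw [← h] at h1 h2
    exact ⟨h1.1, h2.1⟩
  · rintro ⟨h1, h2⟩
    refine (Set.eq_of_subset_of_ncard_le ?_ ?_).symm
    · rintro _ (rfl | rfl)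
      exacts [⟨h1, he⟩, ⟨h2, hf⟩]
    · rw [ncard_edges_at_cycle hU hC hC' h1 he, Set.ncard_pair hef]

theorem two_le_cycleLength (hU : ∀ u ∈ U, FreeGroup.IsCyclicallyReduced u.toWord)
    {C : Graph (Letter n) (WhiteheadEdge U)} (hC : C ≤ whiteheadGraph U) (hC' : IsCycle C) :
    2 ≤ cycleLength C := by
  obtain ⟨v, hv⟩ := hC'.connected.1
  rw [← hC'.degree_eq_two v hv, degree_eq_ncard hU hC]
  exact Set.ncard_le_ncard (fun e he => he.1)

variable {t : ℕ} {C : Fin t → Graph (Letter n) (WhiteheadEdge U)}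

theorem exists_perm_edges_at (hU : ∀ u ∈ U, FreeGroup.IsCyclicallyReduced u.toWord)
    (hC : ∀ k, C k ≤ whiteheadGraph U ∧ IsCycle (C k)) (v : Letter n)
    (h : ∀ e f : WhiteheadEdge U, (whiteheadGraph U).Inc e v → (whiteheadGraph U).Inc f v →
      {k | e ∈ (C k).edgeSet ∧ f ∈ (C k).edgeSet}.ncard =
        {k | connectingMap U v e ∈ (C k).edgeSet ∧
          connectingMap U v f ∈ (C k).edgeSet}.ncard) :
    ∃ b : Equiv.Perm (Fin t), ∀ k,
      {e | e ∈ (C (b k)).edgeSet ∧ (whiteheadGraph U).Inc e v.bar} =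
        connectingMap U v '' {e | e ∈ (C k).edgeSet ∧ (whiteheadGraph U).Inc e v} := by
  refine exists_perm_of_ncard_fiber_eq
    (fun k => connectingMap U v '' {e | e ∈ (C k).edgeSet ∧ (whiteheadGraph U).Inc e v})
    (fun k => {e | e ∈ (C k).edgeSet ∧ (whiteheadGraph U).Inc e v.bar}) ∅ fun z hz => ?_
  have hpair : ∀ k w, {e | e ∈ (C k).edgeSet ∧ (whiteheadGraph U).Inc e w} ≠ ∅ →
      ∃ e f, e ≠ f ∧ (whiteheadGraph U).Inc e w ∧ (whiteheadGraph U).Inc f w ∧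
        {e | e ∈ (C k).edgeSet ∧ (whiteheadGraph U).Inc e w} = {e, f} := by
    intro k w hne
    obtain ⟨e, he⟩ := Set.nonempty_iff_ne_empty.2 hne
    obtain ⟨e, f, hef, heq⟩ := Set.ncard_eq_two.1
      (ncard_edges_at_cycle hU (hC k).1 (hC k).2 he.1 he.2)
    have h1 : e ∈ ({e, f} : Set (WhiteheadEdge U)) := Or.inl rfl
    have h2 : f ∈ ({e, f} : Set (WhiteheadEdge U)) := Or.inr rfl
    rw [← heq] at h1 h2
    exact ⟨e, f, hef, h1.2, h2.2, heq⟩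
  -- A nonempty `z` that is not the image of a pair of edges at `v` has empty fibres on both sides.
  by_cases hcase : ∃ e f, e ≠ f ∧ (whiteheadGraph U).Inc e v ∧ (whiteheadGraph U).Inc f v ∧
      z = {connectingMap U v e, connectingMap U v f}
  · obtain ⟨e, f, hef, he, hf, rfl⟩ := hcase
    have hne : connectingMap U v e ≠ connectingMap U v f := fun heq =>
      hef (connectingMap_injOn hU v he hf heq)
    have h2 : {k | {e | e ∈ (C k).edgeSet ∧ (whiteheadGraph U).Inc e v.bar} =
        {connectingMap U v e, connectingMap U v f}} = {k | connectingMap U v e ∈ (C k).edgeSet ∧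
          connectingMap U v f ∈ (C k).edgeSet} := by
      ext k
      exact edges_at_cycle_eq_pair_iff hU (hC k).1 (hC k).2 hne (inc_connectingMap hU he)
        (inc_connectingMap hU hf)
    rw [h2, ← h e f he hf]
    congr 1
    ext k
    refine Iff.trans ?_ (edges_at_cycle_eq_pair_iff hU (hC k).1 (hC k).2 hef he hf)
    rw [← Set.image_pair]
    refine (connectingMap_injOn hU v).image_eq_image_iff (fun e he => he.2) ?_
    rintro _ (rfl | rfl)
    exacts [he, hf]
  · have h1 : {k | connectingMap U v '' {e | e ∈ (C k).edgeSet ∧ (whiteheadGraph U).Inc e v} = z}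
        = ∅ := by
      refine Set.eq_empty_iff_forall_notMem.2 ?_
      rintro k rfl
      obtain ⟨e, f, hef, he, hf, heq⟩ := hpair k v fun h0 => hz (by rw [h0, Set.image_empty])
      exact hcase ⟨e, f, hef, he, hf, by rw [heq, Set.image_pair]⟩
    have h2 : {k | {e | e ∈ (C k).edgeSet ∧ (whiteheadGraph U).Inc e v.bar} = z} = ∅ := by
      refine Set.eq_empty_iff_forall_notMem.2 ?_
      rintro k rfl
      obtain ⟨e, f, hef, he, hf, heq⟩ := hpair k v.bar hz
      have he' := inc_connectingMap hU he
      have hf' := inc_connectingMap hU hf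
      have hee := connectingMap_connectingMap hU he
      have hff := connectingMap_connectingMap hU hf
      rw [Letter.bar_bar] at he' hf' hee hff
      refine hcase ⟨_, _, fun h0 => hef ?_, he', hf', by rw [heq, hee, hff]⟩
      rw [← hee, h0, hff]
    rw [h1, h2]

theorem exists_turn (hU : ∀ u ∈ U, FreeGroup.IsCyclicallyReduced u.toWord)
    (hC : ∀ k, C k ≤ whiteheadGraph U ∧ IsCycle (C k))
    (h : ∀ (v : Letter n) (e f : WhiteheadEdge U),
      (whiteheadGraph U).Inc e v → (whiteheadGraph U).Inc f v →
      {k | e ∈ (C k).edgeSet ∧ f ∈ (C k).edgeSet}.ncard =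
        {k | connectingMap U v e ∈ (C k).edgeSet ∧
          connectingMap U v f ∈ (C k).edgeSet}.ncard) :
    ∃ β : Letter n → Fin t → Fin t, (∀ v k, β v.bar (β v k) = k) ∧
      ∀ v k e, e ∈ (C k).edgeSet → (whiteheadGraph U).Inc e v →
        connectingMap U v e ∈ (C (β v k)).edgeSet := by
  choose b hb using fun i : Fin n => exists_perm_edges_at hU hC (i, true) (h (i, true))
  -- The permutation is chosen for generators only; inverse letters must use its inverse, so that
  -- traversing an edge back and forth returns to the same cycle.
  refine ⟨fun v => if v.2 then b v.1 else (b v.1).symm, ?_, ?_⟩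
  · rintro ⟨i, _ | _⟩ k <;> simp [Letter.bar]
  · rintro ⟨i, _ | _⟩ k e he hv
    · obtain ⟨k, rfl⟩ := (b i).surjective k
      have hmem : e ∈ {e | e ∈ (C (b i k)).edgeSet ∧
        (whiteheadGraph U).Inc e (Letter.bar (i, true))} := ⟨he, hv⟩
      rw [hb] at hmem
      obtain ⟨e, ⟨he', hv'⟩, rfl⟩ := hmem
      have := connectingMap_connectingMap hU hv'
      simp only [Bool.false_eq_true, if_false, Equiv.symm_apply_apply]
      exact this.symm ▸ he'
    · have hmem : connectingMap U (i, true) e ∈ {e | e ∈ (C (b i k)).edgeSet ∧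
          (whiteheadGraph U).Inc e (Letter.bar (i, true))} := by
        rw [hb]
        exact ⟨e, ⟨he, hv⟩, rfl⟩
      exact hmem.1

/-- Polygonal disks whose corners are the edges of the given cycles, and whose boundaries read
powers of words in `U`. -/
structure CornerSystem (C : Fin t → Graph (Letter n) (WhiteheadEdge U)) (P : Disks) where
  /-- The cycle to which a corner belongs. -/
  index : P.Corner → Fin t
  /-- The edge of the cycle that corresponds to a corner. -/
  edge : P.Corner → WhiteheadEdge U
  mem : ∀ c, edge c ∈ (C (index c)).edgeSet
  exists_corner : ∀ k e, e ∈ (C k).edgeSet → ∃ c, index c = k ∧ edge c = e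
  corner_ext : ∀ c c', index c = index c' → edge c = edge c' → c = c'
  edge_rotate : ∀ c, edge (Disks.rotate c) = (edge c).next
  /-- The cycle at the other end of an edge of the surface, for each cycle and each of its
  vertices. -/
  turn : Letter n → Fin t → Fin t
  turn_bar_turn : ∀ v k, turn v.bar (turn v k) = k
  index_rotate : ∀ c, index (Disks.rotate c) = turn (edge c).secondLetter.bar (index c)

/-- Corners are the pairs of a cycle and one of its edges; `τ` moves to the next edge of the word
and to the cycle matched across the side. Its orbits bound the disks. -/
theorem CornerSystem.exists_of_cycles (hU : ∀ u ∈ U, FreeGroup.IsCyclicallyReduced u.toWord)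
    (hC : ∀ k, C k ≤ whiteheadGraph U ∧ IsCycle (C k))
    (h : ∀ (v : Letter n) (e f : WhiteheadEdge U),
      (whiteheadGraph U).Inc e v → (whiteheadGraph U).Inc f v →
      {k | e ∈ (C k).edgeSet ∧ f ∈ (C k).edgeSet}.ncard =
        {k | connectingMap U v e ∈ (C k).edgeSet ∧
          connectingMap U v f ∈ (C k).edgeSet}.ncard) :
    ∃ P : Disks, Nonempty (CornerSystem C P) := by
  obtain ⟨β, hββ, hβ⟩ := exists_turn hU hC h
  let X := {x : Fin t × WhiteheadEdge U // x.2 ∈ (C x.1).edgeSet}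
  let τ : Equiv.Perm X :=
    { toFun := fun x => ⟨(β x.1.2.secondLetter.bar x.1.1, x.1.2.next), by
        have := hβ _ _ _ x.2 (whiteheadGraph_inc.2 (Or.inr rfl))
        rwa [connectingMap_secondLetter] at this⟩
      invFun := fun x => ⟨(β x.1.2.firstLetter x.1.1, x.1.2.prev), by
        have := hβ _ _ _ x.2 (whiteheadGraph_inc.2 (Or.inl rfl))
        rwa [connectingMap_firstLetter hU] at this⟩
      left_inv := fun x => Subtype.ext (Prod.ext (by
        have := hββ x.1.2.secondLetter.bar x.1.1
        rwa [Letter.bar_bar] at this) (WhiteheadEdge.prev_next _))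
      right_inv := fun x => Subtype.ext (Prod.ext (by
        have := hββ x.1.2.firstLetter x.1.1
        change β x.1.2.prev.secondLetter.bar _ = _
        rwa [WhiteheadEdge.secondLetter_prev]) (WhiteheadEdge.next_prev _)) }
  obtain ⟨P, Φ, hΦ⟩ := Disks.exists_equiv_of_perm τ
  refine ⟨P, ⟨⟨fun c => (Φ c).1.1, fun c => (Φ c).1.2, fun c => (Φ c).2, fun k e he => ?_,
    fun c c' h h' => Φ.injective (Subtype.ext (Prod.ext h h')), fun c => ?_, β, hββ,
    fun c => ?_⟩⟩⟩
  · exact ⟨Φ.symm ⟨(k, e), he⟩, by simp, by simp⟩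
  · rw [hΦ]
    rfl
  · rw [hΦ]
    rfl

/-! ### Gluing the disks to a surface whose links are the given cycles. -/

namespace CornerSystem

variable {P : Disks}

/-- The letter read along an oriented side. -/
def letter (K : CornerSystem C P) (d : P.Dart) : Letter n :=
  if d.2 then (K.edge d.1).secondLetter else (K.edge d.1).secondLetter.bar

theorem letter_true (K : CornerSystem C P) (c : P.Corner) : K.letter (c, true) = (K.edge c).secondLetter := rfl

theorem letter_false (K : CornerSystem C P) (c : P.Corner) : K.letter (c, false) = (K.edge c).secondLetter.bar := rfl

theorem letter_reverse (K : CornerSystem C P) (d : P.Dart) : K.letter (Disks.reverse d) = (K.letter d).bar := by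
  obtain ⟨c, _ | _⟩ := d
  · exact (Letter.bar_bar _).symm
  · rfl

theorem inc (K : CornerSystem C P) (d : P.Dart) :
    (whiteheadGraph U).Inc (K.edge (Disks.source d)) (K.letter d).bar := by
  rw [whiteheadGraph_inc]
  obtain ⟨c, _ | _⟩ := d
  · left
    rw [letter_false, Letter.bar_bar]
    exact (congrArg WhiteheadEdge.firstLetter (K.edge_rotate c)).symm
  · exact Or.inr rfl

theorem index_source_reverse (K : CornerSystem C P) (d : P.Dart) :
    K.index (Disks.source (Disks.reverse d)) =
      K.turn (K.letter d).bar (K.index (Disks.source d)) := by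
  obtain ⟨c, _ | _⟩ := d
  · have h := K.index_rotate c
    change K.index c = K.turn _ (K.index (Disks.rotate c))
    rw [h, letter_false, K.turn_bar_turn]
  · exact K.index_rotate c

theorem dart_ext (K : CornerSystem C P) (hU : ∀ u ∈ U, FreeGroup.IsCyclicallyReduced u.toWord) (d d' : P.Dart)
    (h₁ : K.index (Disks.source d) = K.index (Disks.source d'))
    (h₂ : K.edge (Disks.source d) = K.edge (Disks.source d')) (h : K.letter d = K.letter d') :
    d = d' := by
  have hne : ∀ c, K.letter (Disks.rotate c, true) ≠ K.letter (c, false) := fun c hc => by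
    rw [letter_true, letter_false] at hc
    have h' := (K.edge (Disks.rotate c)).firstLetter_ne hU
    rw [hc, Letter.bar_bar, K.edge_rotate] at h'
    exact h' rfl
  obtain ⟨c₀, h₀⟩ : ∃ c, Disks.source d = c := ⟨_, rfl⟩
  have hs := K.corner_ext _ _ h₁ h₂
  rw [h₀] at hs
  rcases Disks.eq_of_source_eq h₀ with rfl | ⟨c, hc, rfl⟩ <;>
    rcases Disks.eq_of_source_eq hs.symm with rfl | ⟨c', hc', rfl⟩
  · rfl
  · rw [← hc'] at h
    exact absurd h (hne c')
  · rw [← hc] at h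
    exact absurd h.symm (hne c)
  · rw [Disks.rotate_injective (hc.trans hc'.symm)]

theorem exists_dart (K : CornerSystem C P) (k : Fin t) (e : WhiteheadEdge U) (v : Letter n) (he : e ∈ (C k).edgeSet)
    (hv : (whiteheadGraph U).Inc e v) :
    ∃ d, K.index (Disks.source d) = k ∧ K.edge (Disks.source d) = e ∧ (K.letter d).bar = v := by
  obtain ⟨c, rfl, rfl⟩ := K.exists_corner k e he
  rcases whiteheadGraph_inc.1 hv with rfl | rfl
  · obtain ⟨c, rfl⟩ := Disks.exists_rotate_eq c
    refine ⟨(c, false), rfl, rfl, ?_⟩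
    rw [letter_false, Letter.bar_bar, K.edge_rotate]
    rfl
  · exact ⟨(c, true), rfl, rfl, rfl⟩

/-- The cycle has two edges at this vertex, each contributing one oriented side with the given
letter. The other one is the side to glue to. -/
theorem existsUnique_dart (K : CornerSystem C P) (hU : ∀ u ∈ U, FreeGroup.IsCyclicallyReduced u.toWord)
    (hC : ∀ k, C k ≤ whiteheadGraph U ∧ IsCycle (C k)) (d : P.Dart) :
    ∃! d', d' ≠ d ∧ K.index (Disks.source d') = K.index (Disks.source d) ∧
      K.letter d' = K.letter d := by
  have hmem := K.mem (Disks.source d)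
  obtain ⟨e, f, hef, heq⟩ := Set.ncard_eq_two.1
    (ncard_edges_at_cycle hU (hC _).1 (hC _).2 hmem (K.inc d))
  have hd : ∀ d', K.index (Disks.source d') = K.index (Disks.source d) →
      K.letter d' = K.letter d → K.edge (Disks.source d') ∈ ({e, f} : Set (WhiteheadEdge U)) := by
    intro d' h h'
    rw [← heq]
    exact ⟨h ▸ K.mem _, h' ▸ K.inc d'⟩
  obtain ⟨g, hg, hne⟩ : ∃ g ∈ ({e, f} : Set (WhiteheadEdge U)), g ≠ K.edge (Disks.source d) := by
    rcases hd d rfl rfl with h | h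
    · exact ⟨f, Or.inr rfl, h ▸ hef.symm⟩
    · exact ⟨e, Or.inl rfl, h.symm ▸ hef⟩
  have hg' := hg
  rw [← heq] at hg'
  obtain ⟨d', h1, rfl, h3⟩ := K.exists_dart _ g _ hg'.1 hg'.2
  refine ⟨d', ⟨by rintro rfl; exact hne rfl, h1, Letter.bar_injective h3⟩, ?_⟩
  rintro d'' ⟨h1', h2', h3'⟩
  refine K.dart_ext hU _ _ (h2'.trans h1.symm) ?_ (h3'.trans (Letter.bar_injective h3).symm)
  have hne' : K.edge (Disks.source d'') ≠ K.edge (Disks.source d) := fun h =>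
    h1' (K.dart_ext hU _ _ h2' h h3')
  rcases hd d rfl rfl with h | h <;> rcases hg with h' | h' <;>
    rcases hd d'' h2' h3' with h'' | h'' <;> grind

theorem isRotated_boundary (K : CornerSystem C P) (hU : ∀ u ∈ U, FreeGroup.IsCyclicallyReduced u.toWord)
    (i : Fin P.num) :
    ∃ u ∈ U, ∃ k : ℤ, k ≠ 0 ∧
      (List.ofFn fun j : Fin (P.sides i) => K.letter (⟨i, j⟩, true)).IsRotated (u ^ k).toWord := by
  let z : Fin (P.sides i) := ⟨0, P.sides_pos i⟩
  let w := (K.edge ⟨i, z⟩).1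
  have hw : ∀ m, ∃ j, K.edge ⟨i, (finRotate _)^[m] z⟩ = ⟨w, j⟩ := by
    intro m
    induction m with
    | zero => exact ⟨_, rfl⟩
    | succ m ih =>
      obtain ⟨j, hj⟩ := ih
      have h := K.edge_rotate ⟨i, (finRotate _)^[m] z⟩
      rw [hj] at h
      refine ⟨finRotate _ j, ?_⟩
      rw [Function.iterate_succ_apply']
      exact h
  have hw' : ∀ k, ∃ j, K.edge ⟨i, k⟩ = ⟨w, j⟩ := by
    intro k
    have hk : k = (finRotate _)^[(k : ℕ)] z := by
      ext
      rw [coe_iterate_finRotate]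
      simp [z, Nat.mod_eq_of_lt k.2]
    obtain ⟨j, hj⟩ := hw k
    rw [← hk] at hj
    exact ⟨j, hj⟩
  choose ρ hρ using hw'
  have hrot : ∀ k, ρ (finRotate _ k) = finRotate _ (ρ k) := by
    intro k
    have h := K.edge_rotate ⟨i, k⟩
    rw [hρ] at h
    have h' : (⟨w, ρ (finRotate _ k)⟩ : WhiteheadEdge U) = ⟨w, finRotate _ (ρ k)⟩ :=
      (hρ _).symm.trans h
    exact eq_of_heq (Sigma.mk.inj h').2
  obtain ⟨N, hN, h⟩ := isRotated_flatten_replicate_of_semiconj (U.get w).toWord _ (P.sides_pos i)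
    -- The outgoing side at a corner reads the second letter of its label, hence the shift by one.
    (fun k => finRotate _ (ρ k)) fun k => congrArg _ (hrot k)
  refine ⟨U.get w, List.get_mem _ _, N, by exact_mod_cast hN, ?_⟩
  rw [zpow_natCast, (hU _ (List.get_mem _ _)).toWord_pow]
  convert h using 3 with k
  rw [letter_true, hρ]
  rfl

theorem card_corner (K : CornerSystem C P) : Nat.card P.Corner = ∑ k, cycleLength (C k) := by
  classical
  rw [Nat.card_eq_fintype_card, ← Finset.card_univ,
    Finset.card_eq_sum_card_fiberwise (t := Finset.univ) (f := K.index) (fun _ _ => by simp)]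
  refine Finset.sum_congr rfl fun k _ => ?_
  rw [← Set.ncard_coe_finset, Finset.coe_filter_univ, cycleLength]
  have hinj : Set.InjOn K.edge {c | K.index c = k} := fun c hc c' hc' h =>
    K.corner_ext c c' (hc.trans hc'.symm) h
  rw [← hinj.ncard_image]
  congr 1
  ext e
  constructor
  · rintro ⟨c, rfl, rfl⟩
    exact K.mem c
  · intro he
    obtain ⟨c, hc, hc'⟩ := K.exists_corner k e he
    exact ⟨c, hc, hc'⟩

theorem isPolygonal (K : CornerSystem C P) (hU : ∀ u ∈ U, FreeGroup.IsCyclicallyReduced u.toWord)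
    (hC : ∀ k, C k ≤ whiteheadGraph U ∧ IsCycle (C k)) (hlen : ∃ k, 3 ≤ cycleLength (C k)) :
    IsPolygonal U := by
  choose γ hγ hγu using K.existsUnique_dart hU hC
  have hγγ : ∀ d, γ (γ d) = d := fun d =>
    (hγu (γ d) d ⟨(hγ d).1.symm, (hγ d).2.1.symm, (hγ d).2.2.symm⟩).symm
  have hrev : ∀ d, γ (Disks.reverse d) = Disks.reverse (γ d) := by
    intro d
    refine (hγu _ _ ⟨fun h => (hγ d).1 ?_, ?_, ?_⟩).symm
    · rw [← Disks.reverse_reverse (γ d), h, Disks.reverse_reverse]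
    · rw [K.index_source_reverse, K.index_source_reverse, (hγ d).2.1, (hγ d).2.2]
    · rw [K.letter_reverse, K.letter_reverse, (hγ d).2.2]
  -- A side glued to its own reverse would carry a letter equal to its inverse.
  have hne : ∀ d, (γ d).1 ≠ d.1 := by
    intro d h
    by_cases hb : (γ d).2 = d.2
    · exact (hγ d).1 (Prod.ext h hb)
    · have hr : γ d = Disks.reverse d := Prod.ext h (Bool.eq_not.2 hb)
      have := (hγ d).2.2
      rw [hr, K.letter_reverse] at this
      exact Letter.bar_ne _ this
  obtain ⟨S, rfl⟩ := SidePairing.exists_glue_eq γ hγγ hrev hne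
  let φ : S.RoseMap n := ⟨K.letter, K.letter_reverse, fun d => (hγ d).2.2⟩
  have hindex : ∀ c c' : P.Corner, S.vertex c = S.vertex c' → K.index c = K.index c' := by
    intro c c' h
    let F : S.Vertex → Fin t := Quot.lift K.index fun p q => by
      rintro ⟨d, rfl, rfl⟩
      exact (hγ d).2.1.symm
    exact congrArg F h
  have himm : φ.IsImmersion := by
    intro d d' h h'
    by_cases hd : d' = d
    · exact Or.inl hd
    · exact Or.inr (hγu d d' ⟨hd, (hindex _ _ h).symm, h'.symm⟩)
  refine ⟨P, S, φ, himm, K.isRotated_boundary hU, ?_⟩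
  have hstar : ∀ d d', K.index (Disks.source d) = K.index (Disks.source d') →
      K.letter d = K.letter d' → S.vertex (Disks.source d) = S.vertex (Disks.source d') := by
    intro d d' h h'
    by_cases hd : d' = d
    · rw [hd]
    · rw [hγu d d' ⟨hd, h.symm, h'.symm⟩, S.vertex_source_glue]
  -- A path in the connected cycle is followed: each edge passes through one corner, and each vertex
  -- crosses a glued side.
  have hcorner : ∀ c c', K.index c = K.index c' → S.vertex c = S.vertex c' := by
    intro c c' h
    have hconn := (hC (K.index c)).2.connected.2
    have hlink : ∀ d : P.Dart, K.index (Disks.source d) = K.index c →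
        (K.letter d).bar ∈ (C (K.index c)).vertexSet := by
      intro d hd
      obtain ⟨y, hy⟩ := K.inc d
      exact ((Graph.IsSubgraph.isLink_iff (hC (K.index c)).1 (hd ▸ K.mem _)).2 hy).left_mem
    have hpath := hconn _ (hlink (c, true) rfl) _ (hlink (c', true) h.symm)
    have key : ∀ v, Relation.ReflTransGen (C (K.index c)).Adj (K.letter (c, true)).bar v →
        ∀ d : P.Dart, K.index (Disks.source d) = K.index c → (K.letter d).bar = v →
        S.vertex c = S.vertex (Disks.source d) := by
      intro v hv
      induction hv with
      | refl =>
        intro d hd hl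
        exact hstar (c, true) d hd.symm (Letter.bar_injective hl).symm
      | tail _ hadj ih =>
        intro d hd hl
        obtain ⟨e, he⟩ := hadj
        have he' := Graph.IsLink.mono (hC (K.index c)).1 he
        obtain ⟨d₁, h1, h2, h3⟩ := K.exists_dart _ e _ he.edge_mem he'.inc_left
        obtain ⟨d₂, h1', h2', h3'⟩ := K.exists_dart _ e _ he.edge_mem he'.inc_right
        rw [ih d₁ h1 h3, K.corner_ext _ _ (h1.trans h1'.symm) (h2.trans h2'.symm)]
        exact hstar d₂ d (h1'.trans hd.symm) (Letter.bar_injective (h3'.trans hl.symm))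
    exact key _ hpath (c', true) h.symm rfl
  have hV : Nat.card S.Vertex ≤ t := by
    let F : S.Vertex → Fin t := Quot.lift K.index fun p q => by
      rintro ⟨d, rfl, rfl⟩
      exact (hγ d).2.1.symm
    have hF : Function.Injective F := by
      intro p q h
      obtain ⟨c, rfl⟩ := Quot.exists_rep p
      obtain ⟨c', rfl⟩ := Quot.exists_rep q
      exact hcorner c c' h
    simpa using Nat.card_le_card_of_injective F hF
  rw [S.eulerChar_lt_iff]
  change _ < Nat.card P.Corner
  rw [K.card_corner]
  obtain ⟨k, hk⟩ := hlen
  have hlt : ∑ _k : Fin t, 2 < ∑ k, cycleLength (C k) :=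
    Finset.sum_lt_sum (fun j _ => two_le_cycleLength hU (hC j).1 (hC j).2)
      ⟨k, Finset.mem_univ _, hk⟩
  simp only [Finset.sum_const, Finset.card_univ, Fintype.card_fin, smul_eq_mul] at hlt
  lia

end CornerSystem

end Cycles

end Polygonality

theorem mainTheorem7 (n : ℕ) (hn : 1 < n) (U : List (FreeGroup (Fin n)))
    (hU : ∀ u ∈ U, FreeGroup.IsCyclicallyReduced u.toWord) :
    Polygonality.IsPolygonal U ↔
      ∃ (t : ℕ) (C : Fin t → Graph (Polygonality.Letter n) (Polygonality.WhiteheadEdge U)),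
        0 < t ∧
        (∀ k, C k ≤ Polygonality.whiteheadGraph U ∧ Polygonality.IsCycle (C k)) ∧
        (∃ k, 3 ≤ Polygonality.cycleLength (C k)) ∧
        ∀ (v : Polygonality.Letter n) (e f : Polygonality.WhiteheadEdge U),
          (Polygonality.whiteheadGraph U).Inc e v →
          (Polygonality.whiteheadGraph U).Inc f v →
          {k | e ∈ (C k).edgeSet ∧ f ∈ (C k).edgeSet}.ncard =
            {k | Polygonality.connectingMap U v e ∈ (C k).edgeSet ∧
              Polygonality.connectingMap U v f ∈ (C k).edgeSet}.ncard := by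
  refine ⟨Polygonality.exists_cycles_of_isPolygonal hU, ?_⟩
  rintro ⟨t, C, -, hC, hlen, hcount⟩
  obtain ⟨P, ⟨K⟩⟩ := Polygonality.CornerSystem.exists_of_cycles hU hC hcount
  exact K.isPolygonal hU hC hlen
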